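/- **Setting.** Fix a finite universe $\mathcal U$ and a size parameter $n$ (for instance $n=|\mathcal U|$), a stream length $m\ge 2$ polynomially related to $n$ ($m\le n^b$, $n\le m^b$), a window parameter $W\ge1$, and a word size $w=\Theta(\log m)$ ($m<2^w$, $w\le\kappa\log m$). A streaming algorithm has a memory of finitely many $w$-bit cells, initially zero. On each arriving update it runs a randomized program that in one step reads a cell, writes a cell, or draws a uniformly random word, and at the end returns its current output. Its update time is the worst-case number of steps per update (the arrival of the update counting as one step). Its space, in bits, is $w$ times the number of cells plus the logarithm (base 2) of the number of control states of its programs. Algorithms may depend on all parameters. A private algorithm returns a pair $(x,b)$, $b\ge0$, and at the end of the stream releases a sample of the Laplace distribution with mean $x$ and scale $b$ (the point mass at $x$ if $b=0$). Streams are neighboring if they have the same length and differ in at most one update; $(\varepsilon,\delta)$-differential privacy refers to neighboring streams of length $m$ and to the number released at the end. $\Delta_f$ is the maximum of $|f(D)-f(D')|$ over neighboring $D,D'$ consisting of $\min(m,W)$ updates. A real function $f$ of streams is $(\rho,\beta(\rho))$-smooth if $0<\beta(\rho)\le\rho$ and, for all nonempty streams of length at most $m$: $1\le f\le n^q$; $f(B)\le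 f(A)$ whenever $B$ is a suffix of $A$; and if $B$ is a suffix of $A$ with $(1-\beta(\rho))f(A)\le f(B)$, then $(1-\rho)f(AC)\le f(BC)$ for every continuation $C$ (with $AC$ of length at most $m$). **Theorem (DP smooth histogram framework).** For every $c>0$ (and fixed $q,b,\kappa$) there are constants $C_1,C_2,C_3\ge 1$ and $k\in\mathbb N$, depending only on these, such that the following holds for all $\mathcal U,m,n,w,W$ as above, all $\alpha\in(0,1)$ and $\varepsilon>0$. Let $\eta=\min(\varepsilon,1)$ and $0<\rho\le\frac{\alpha\eta}{C_1\log m}$, and let $f$ be $(\rho,\beta(\rho))$-smooth. Suppose that for all $a,d\in(0,1)$ there is an insertion-only streaming algorithm that uses space at most $\mathcal S(a,d,m,n)$ and update time at most $\mathcal T(a,d,m,n)$ and whose output, after any nonempty stream $D$ of length at most $m$, lies in $[(1-a)f(D),(1+a)f(D)]$ with probability at least $1-d$. Put $\delta=m^{-c}$ and $\delta'=\delta/(mn)^k$. Then there is a streaming algorithm $\mathcal A'$ (in the sliding window model) such that, $\mathcal W$ denoting the last $\min(m,W)$ updates of the stream: 1. (Privacy) $\mathcal A'$ is $(\varepsilon,\delta)$-differentially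 private. 2. (Accuracy) On every stream of length $m$, with probability at least $1-m^{-c}$ the released number $\widehat f(\mathcal W)$ satisfies $$(1-\alpha)f(\mathcal W)-\frac{6c\,\Delta_f\log m}{\varepsilon}\le\widehat f(\mathcal W)\le(1+\alpha)f(\mathcal W)+\frac{6c\,\Delta_f\log m}{\varepsilon}.$$ 3. (Space and time) $\mathcal A'$ uses space at most $C_3\,\frac1{\beta(\rho)}\bigl(\mathcal S(\beta(\rho)/C_2,\delta',m,n)+\log m\bigr)\log m$ and update time at most $C_3\,\frac1{\beta(\rho)}\,\mathcal T(\beta(\rho)/C_2,\delta',m,n)\log m$. -/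

import Mathlib

open scoped NNReal ENNReal

noncomputable section

namespace DPHist

/-! ### The machine model -/

/-- A machine word of `w` bits, read as a natural number below `2 ^ w`. -/
abbrev Word (w : ℕ) : Type := Fin (2 ^ w)

/-- The contents of a memory of `s` cells, each holding one word of `w` bits. -/
abbrev Mem (w s : ℕ) : Type := Fin s → Word w

/-- The memory all of whose cells hold the word `0`. -/
def zeroMem (w s : ℕ) : Mem w s := fun _ => ⟨0, Nat.two_pow_pos w⟩

/-- A randomized random-access program on a memory of `s` cells of `w` bits. In one step it reads a
cell, writes a cell, or draws a uniformly random word; it stops by returning a value. -/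
inductive Prog (w s : ℕ) (O : Type) : Type
  | ret (o : O) : Prog w s O
  | read (i : Fin s) (k : Word w → Prog w s O) : Prog w s O
  | write (i : Fin s) (x : Word w) (p : Prog w s O) : Prog w s O
  | rand (k : Word w → Prog w s O) : Prog w s O

namespace Prog

variable {w s : ℕ} {O : Type}

/-- The joint law of the returned value and the final memory. -/
def run : Prog w s O → Mem w s → PMF (O × Mem w s)
  | ret o, M => PMF.pure (o, M)
  | read i k, M => (k (M i)).run M
  | write i x p, M => p.run (Function.update M i x)
  | rand k, M => (PMF.uniformOfFintype (Word w)).bind fun x => (k x).run M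

/-- The worst-case number of steps. -/
def cost : Prog w s O → ℕ
  | ret _ => 0
  | read _ k => 1 + Finset.univ.sup fun x => (k x).cost
  | write _ _ p => 1 + p.cost
  | rand k => 1 + Finset.univ.sup fun x => (k x).cost

/-- The control states that the program can go through: the distinct programs that may remain to be
executed at some moment. What the processor remembers while it is running is exactly which one of
them is left, so the logarithm of their number is the size of its working memory. -/
def residuals : Prog w s O → Set (Prog w s O)
  | ret o => {ret o}
  | read i k => insert (read i k) (⋃ x, (k x).residuals)
  | write i x p => insert (write i x p) p.residuals
  | rand k => insert (rand k) (⋃ x, (k x).residuals)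

end Prog

/-- A one-pass streaming algorithm over the universe `U` on a machine with words of `w` bits: it has
`cells` memory cells, all initially zero, and on every arriving update `u` it executes the program
`step u`, which modifies the memory and returns the current output. -/
structure StreamAlg (w : ℕ) (U O : Type) where
  cells : ℕ
  step : U → Prog w cells O

namespace StreamAlg

variable {w : ℕ} {U O : Type}

/-- The joint law of the latest output (`none` before the first update) and of the memory after the
updates of the list have been processed from left to right. -/
def exec (A : StreamAlg w U O) (σ : List U) : PMF (Option O × Mem w A.cells) :=
  σ.foldl (fun μ u => μ.bind fun x => ((A.step u).run x.2).map fun y => (some y.1, y.2))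
    (PMF.pure (none, zeroMem w A.cells))

/-- The law of the output after the whole stream has been processed. -/
def outputLaw (A : StreamAlg w U O) (σ : List U) : PMF (Option O) := (A.exec σ).map Prod.fst

/-- Space in bits: the memory cells together with the working memory (see `Prog.residuals`). -/
def spaceBits (A : StreamAlg w U O) : ℝ :=
  (A.cells : ℝ) * w + Real.logb 2 ((⋃ u, (A.step u).residuals).ncard : ℝ)

/-- Processing one update, whose arrival itself counts as one step, takes at most `t` steps. -/
def UpdateTimeLE (A : StreamAlg w U O) (t : ℝ) : Prop :=
  ∀ u, ((1 + (A.step u).cost : ℕ) : ℝ) ≤ t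

/-- In the insertion-only model, on every nonempty stream of length at most `m`, the output is
between `(1 - a) f` and `(1 + a) f` with probability at least `1 - d`. -/
def IsApprox (A : StreamAlg w U ℝ) (f : List U → ℝ) (m : ℕ) (a d : ℝ) : Prop :=
  ∀ σ : List U, σ ≠ [] → σ.length ≤ m →
    ENNReal.ofReal (1 - d) ≤ (A.outputLaw σ).toOuterMeasure
      {o | ∃ v, o = some v ∧ (1 - a) * f σ ≤ v ∧ v ≤ (1 + a) * f σ}

end StreamAlg

/-! ### Laplace noise and differential privacy -/

/-- The Laplace distribution with mean `μ` and scale `b`; for `b = 0` the point mass at `μ`. -/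
def laplace (μ : ℝ) (b : ℝ≥0) : MeasureTheory.Measure ℝ :=
  if b = 0 then MeasureTheory.Measure.dirac μ
  else MeasureTheory.volume.withDensity
    fun x => ENNReal.ofReal (1 / (2 * b) * Real.exp (-|x - μ| / b))

/-- The law of the number that is released at the end of the stream by an algorithm whose output is
a pair `(x, b)`: a fresh sample of the Laplace distribution with mean `x` and scale `b`. -/
def StreamAlg.releaseLaw {w : ℕ} {U : Type} (A : StreamAlg w U (ℝ × ℝ≥0)) (σ : List U) :
    MeasureTheory.Measure ℝ :=
  MeasureTheory.Measure.sum fun o : ℝ × ℝ≥0 => A.outputLaw σ (some o) • laplace o.1 o.2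

/-- Two streams of the same length that differ in at most one update. -/
def Neighboring {U : Type} (σ τ : List U) : Prop :=
  ∃ (l r : List U) (a b : U), σ = l ++ a :: r ∧ τ = l ++ b :: r

/-- `(ε, δ)`-differential privacy of a mechanism on streams of length `m`. -/
def IsDP {U : Type} (M : List U → MeasureTheory.Measure ℝ) (m : ℕ) (ε δ : ℝ) : Prop :=
  ∀ σ τ : List U, σ.length = m → τ.length = m → Neighboring σ τ →
    ∀ E : Set ℝ, MeasurableSet E →
      M σ E ≤ ENNReal.ofReal (Real.exp ε) * M τ E + ENNReal.ofReal δ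

/-- The global sensitivity of `f` on datasets consisting of `ℓ` updates. -/
def globalSensitivity {U : Type} (f : List U → ℝ) (ℓ : ℕ) : ℝ :=
  sSup {d | ∃ σ τ : List U, σ.length = ℓ ∧ τ.length = ℓ ∧ Neighboring σ τ ∧ d = |f σ - f τ|}

/-! ### Smooth functions -/

/-- `f` is `(ρ, ξ)`-smooth on the nonempty streams of length at most `m`, with the polynomial bound
`n ^ q`. Here `B <:+ A` says that `B` is a suffix of `A`. -/
structure IsSmooth {U : Type} (f : List U → ℝ) (m n q : ℕ) (ρ ξ : ℝ) : Prop where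
  one_le : ∀ A : List U, A ≠ [] → A.length ≤ m → 1 ≤ f A
  mono : ∀ A B : List U, B ≠ [] → B <:+ A → A.length ≤ m → f B ≤ f A
  bounded : ∀ A : List U, A ≠ [] → A.length ≤ m → f A ≤ (n : ℝ) ^ q
  pos : 0 < ξ
  le : ξ ≤ ρ
  smooth : ∀ A B C : List U, B ≠ [] → B <:+ A → (A ++ C).length ≤ m →
    (1 - ξ) * f A ≤ f B → (1 - ρ) * f (A ++ C) ≤ f (B ++ C)

end DPHist

end

/-! The algorithm is a smooth histogram: a copy of the insertion-only algorithm is started at every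
position, and a copy is dropped when an earlier and a later one have estimates that agree up to the
factor `1 - β / 2`. Smoothness makes closeness of two suffix values persist under every
continuation, so each position stays covered by a surviving start that is not later
(`Covers.removal`, `CoversAt.smooth`). Hence the last copy started no later than the window is
correct up to `1 ± 2 * ρ` (`Covers.approx`). As `f` lies between `1` and `n ^ q`, and values two
survivors apart drop by a constant factor, only `O(log m / β)` copies survive (`card_pruned_le`).

All this is deterministic while no copy errs. The failure probability is at most the expected number
of bad outputs of copies, bounded by a potential that sums over the living copies and all future
births (`future_le`). Only linearity of expectation is used, never independence, and the total is `m
^ 2 * d` (`outputLaw_bad_le`).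

For privacy, good estimates on neighboring streams differ by at most `Δ` plus a multiple of `ρ`
times the value, so Laplace noise of scale proportional to `(Δ + 8 * ρ * v) / ε` hides the
difference. This scale depends on the data, but only by a relative `9 * ρ`; away from the tails that
costs a factor `exp (O(ρ * log m))` (`laplace_le`, `noiseScale_sub_le`). The condition `ρ ≤ α * min
ε 1 / (C₁ * log m)` makes this cost small against `ε`, and the extra noise small against `α * f`.
`expect_le_of_good` passes from fixed outputs to their random laws.

On the machine, memory stamped with birth times lets a slot be reset by one write. The space bound
also counts control states (`residuals_update_subset`): a real number held by the processor is an
initial `0` or a value returned by the simulated program, hence one of finitely many. -/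

noncomputable section

namespace DPHist

/-! ### Expectations -/

/-- The expectation of a nonnegative function under a discrete law. -/
def expect {α : Type} (μ : PMF α) (φ : α → ℝ≥0∞) : ℝ≥0∞ := ∑' a, μ a * φ a

section expect

variable {α γ : Type}

theorem expect_pure (a : α) (φ : α → ℝ≥0∞) : expect (PMF.pure a) φ = φ a := by
  unfold expect
  rw [tsum_eq_single a]
  · simp
  · intro b hb
    simp [PMF.pure_apply, hb]

theorem expect_bind (μ : PMF α) (k : α → PMF γ) (φ : γ → ℝ≥0∞) :
    expect (μ.bind k) φ = expect μ fun a => expect (k a) φ := by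
  unfold expect
  simp_rw [PMF.bind_apply, ← ENNReal.tsum_mul_right, ← ENNReal.tsum_mul_left]
  rw [ENNReal.tsum_comm]
  simp_rw [mul_assoc]

theorem expect_map (μ : PMF α) (g : α → γ) (φ : γ → ℝ≥0∞) :
    expect (μ.map g) φ = expect μ fun a => φ (g a) := by
  rw [← PMF.bind_pure_comp, expect_bind]
  simp [expect_pure]

theorem expect_mono (μ : PMF α) {φ ψ : α → ℝ≥0∞} (h : ∀ a, φ a ≤ ψ a) :
    expect μ φ ≤ expect μ ψ :=
  ENNReal.tsum_le_tsum fun a => by gcongr; exact h a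

theorem expect_add (μ : PMF α) (φ ψ : α → ℝ≥0∞) :
    expect μ (fun a => φ a + ψ a) = expect μ φ + expect μ ψ := by
  unfold expect
  simp_rw [mul_add]
  exact ENNReal.tsum_add

theorem expect_const (μ : PMF α) (C : ℝ≥0∞) : expect μ (fun _ => C) = C := by
  unfold expect
  rw [ENNReal.tsum_mul_right, μ.tsum_coe, one_mul]

theorem expect_indicator (μ : PMF α) (s : Set α) :
    expect μ (s.indicator fun _ => 1) = μ.toOuterMeasure s := by
  unfold expect
  rw [PMF.toOuterMeasure_apply]
  refine tsum_congr fun a => ?_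
  by_cases h : a ∈ s <;> simp [h]

theorem toOuterMeasure_add_compl (μ : PMF α) (s : Set α) :
    μ.toOuterMeasure s + μ.toOuterMeasure sᶜ = 1 := by
  rw [← expect_indicator, ← expect_indicator, ← expect_add]
  refine Eq.trans (congrArg (expect μ) (funext fun a => ?_)) (expect_const μ 1)
  by_cases h : a ∈ s <;> simp [h]

end expect

namespace Prog

variable {w s : ℕ} {O O' : Type}

/-! ### Sequential composition -/

/-- Run `p`, then continue with the program selected by the value that `p` returns. -/
def bind : Prog w s O → (O → Prog w s O') → Prog w s O'
  | ret o, k => k o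
  | read i r, k => read i fun x => (r x).bind k
  | write i x p, k => write i x (p.bind k)
  | rand r, k => rand fun x => (r x).bind k

/-- The expectation of a function of the returned value and the final memory. -/
def wp : Prog w s O → (O × Mem w s → ℝ≥0∞) → Mem w s → ℝ≥0∞
  | ret o, Φ, M => Φ (o, M)
  | read i k, Φ, M => (k (M i)).wp Φ M
  | write i x p, Φ, M => p.wp Φ (Function.update M i x)
  | rand k, Φ, M => expect (PMF.uniformOfFintype (Word w)) fun x => (k x).wp Φ M

/-- Laws of programs are handled only through `wp`, which pulls a postcondition back through the
program; the joint law of output and memory never has to be described. -/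
theorem expect_run (p : Prog w s O) (Φ : O × Mem w s → ℝ≥0∞) (M : Mem w s) :
    expect (p.run M) Φ = p.wp Φ M := by
  induction p generalizing M with
  | ret o => simp [run, wp, expect_pure]
  | read i k ih => simp [run, wp, ih]
  | write i x p ih => simp [run, wp, ih]
  | rand k ih => simp [run, wp, ih, expect_bind]

theorem wp_mono (p : Prog w s O) {Φ Ψ : O × Mem w s → ℝ≥0∞} (h : ∀ y, Φ y ≤ Ψ y) (M : Mem w s) :
    p.wp Φ M ≤ p.wp Ψ M := by
  rw [← expect_run, ← expect_run]
  exact expect_mono _ h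

theorem wp_add (p : Prog w s O) (Φ Ψ : O × Mem w s → ℝ≥0∞) (M : Mem w s) :
    p.wp (fun y => Φ y + Ψ y) M = p.wp Φ M + p.wp Ψ M := by
  simp_rw [← expect_run]
  exact expect_add _ _ _

theorem wp_const (p : Prog w s O) (C : ℝ≥0∞) (M : Mem w s) : p.wp (fun _ => C) M = C := by
  rw [← expect_run]
  exact expect_const _ _

theorem wp_bind (p : Prog w s O) (k : O → Prog w s O') (Φ : O' × Mem w s → ℝ≥0∞) (M : Mem w s) :
    (p.bind k).wp Φ M = p.wp (fun y => (k y.1).wp Φ y.2) M := by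
  induction p generalizing M with
  | ret o => simp [bind, wp]
  | read i k ih => simp [bind, wp, ih]
  | write i x p ih => simp [bind, wp, ih]
  | rand k ih => simp [bind, wp, ih]

theorem cost_bind_le (p : Prog w s O) (k : O → Prog w s O') {C : ℕ} (hk : ∀ o, (k o).cost ≤ C) :
    (p.bind k).cost ≤ p.cost + C := by
  induction p with
  | ret o => simpa [bind, cost] using hk o
  | read i r ih =>
    simp only [bind, cost, add_assoc]
    gcongr
    refine Finset.sup_le fun x _ => (ih x).trans ?_
    gcongr
    exact Finset.le_sup (f := fun x => (r x).cost) (Finset.mem_univ x)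
  | write i x p ih =>
    simp only [bind, cost, add_assoc]
    gcongr
  | rand r ih =>
    simp only [bind, cost, add_assoc]
    gcongr
    refine Finset.sup_le fun x _ => (ih x).trans ?_
    gcongr
    exact Finset.le_sup (f := fun x => (r x).cost) (Finset.mem_univ x)

/-! ### Control states -/

theorem mem_residuals_self (p : Prog w s O) : p ∈ p.residuals := by
  cases p <;> simp [residuals]

theorem finite_residuals (p : Prog w s O) : p.residuals.Finite := by
  induction p with
  | ret o => simp [residuals]
  | read i k ih => exact (Set.finite_iUnion ih).insert _
  | write i x p ih => exact ih.insert _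
  | rand k ih => exact (Set.finite_iUnion ih).insert _

/-- A control state of the composition is a state of `p` with `k` still to come, or a state of `k o`
for a value `o` that `p` can really return. The target `T` is arbitrary so that it can later be the
range of an explicit finite indexing. -/
theorem residuals_bind_subset (p : Prog w s O) (k : O → Prog w s O') {T : Set (Prog w s O')}
    (hp : ∀ r ∈ p.residuals, r.bind k ∈ T)
    (hk : ∀ o, ret o ∈ p.residuals → (k o).residuals ⊆ T) : (p.bind k).residuals ⊆ T := by
  induction p with
  | ret o => exact hk o (by simp [residuals])
  | read i r ih =>
    simp only [bind, residuals, Set.insert_subset_iff, Set.iUnion_subset_iff]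
    refine ⟨hp _ (mem_residuals_self _), fun x => ih x (fun r' hr' => hp r' ?_)
      fun o ho => hk o ?_⟩
    · exact Set.mem_insert_of_mem _ (Set.mem_iUnion.2 ⟨x, hr'⟩)
    · exact Set.mem_insert_of_mem _ (Set.mem_iUnion.2 ⟨x, ho⟩)
  | write i x p ih =>
    simp only [bind, residuals, Set.insert_subset_iff]
    exact ⟨hp _ (mem_residuals_self _), ih (fun r' hr' => hp r' (Set.mem_insert_of_mem _ hr'))
      fun o ho => hk o (Set.mem_insert_of_mem _ ho)⟩
  | rand r ih =>
    simp only [bind, residuals, Set.insert_subset_iff, Set.iUnion_subset_iff]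
    refine ⟨hp _ (mem_residuals_self _), fun x => ih x (fun r' hr' => hp r' ?_)
      fun o ho => hk o ?_⟩
    · exact Set.mem_insert_of_mem _ (Set.mem_iUnion.2 ⟨x, hr'⟩)
    · exact Set.mem_insert_of_mem _ (Set.mem_iUnion.2 ⟨x, ho⟩)

end Prog

end DPHist

end

noncomputable section

namespace DPHist

/-! ### A machine that runs several copies of a program

The memory consists of a clock, and of `L` slots. Every slot has a header, which holds the birth
time of the copy that lives there (`0` if the slot is free), and for each of the `c` cells of the
simulated program a value and a stamp. The value is valid only if the stamp agrees with the header;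
otherwise the simulated cell holds `0`. So a slot is reset by changing its header. -/

/-- The addresses of the clock, the headers, the stamps and the values. -/
abbrev Loc (L c : ℕ) : Type := Unit ⊕ Fin L ⊕ (Fin L × Fin c) ⊕ (Fin L × Fin c)

/-- The number of cells of the machine. -/
abbrev numCells (L c : ℕ) : ℕ := Fintype.card (Loc L c)

/-- The word `0`. -/
def zeroWord (w : ℕ) : Word w := ⟨0, Nat.two_pow_pos w⟩

/-- The successor of a word modulo `2 ^ w`. -/
def succWord {w : ℕ} (x : Word w) : Word w :=
  ⟨((x : ℕ) + 1) % 2 ^ w, Nat.mod_lt _ (Nat.two_pow_pos w)⟩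

section layout

variable {L c : ℕ}

/-- The numbering of the addresses. -/
def addr : Loc L c ≃ Fin (numCells L c) := Fintype.equivFin _

/-- The clock. -/
def clk : Fin (numCells L c) := addr (.inl ())

/-- The header of a slot. -/
def hdr (i : Fin L) : Fin (numCells L c) := addr (.inr (.inl i))

/-- The stamp of a simulated cell. -/
def stamp (i : Fin L) (j : Fin c) : Fin (numCells L c) := addr (.inr (.inr (.inl (i, j))))

/-- The value of a simulated cell. -/
def val (i : Fin L) (j : Fin c) : Fin (numCells L c) := addr (.inr (.inr (.inr (i, j))))

end layout

namespace Prog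

variable {w c L : ℕ} {O O' : Type}

/-- Simulation of a program on the slot `i` whose header is `h`. -/
def virt (i : Fin L) (h : Word w) : Prog w c O → Prog w (numCells L c) O
  | ret o => ret o
  | read j k => read (stamp i j) fun x =>
      if x = h then read (val i j) fun y => virt i h (k y) else virt i h (k (zeroWord w))
  | write j x p => write (stamp i j) h (write (val i j) x (virt i h p))
  | rand k => rand fun x => virt i h (k x)

/-- The simulated memory of the slot `i` if its header is `h`. -/
def view (M : Mem w (numCells L c)) (i : Fin L) (h : Word w) : Mem w c :=
  fun j => if M (stamp i j) = h then M (val i j) else zeroWord w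

/-- `M'` can arise from `M` by simulating programs on the slot `i` with header `h`. -/
structure Frame (i : Fin L) (h : Word w) (M M' : Mem w (numCells L c)) : Prop where
  clk_eq : M' clk = M clk
  stamp_eq : ∀ i' ≠ i, ∀ j, M' (stamp i' j) = M (stamp i' j)
  val_eq : ∀ i' ≠ i, ∀ j, M' (val i' j) = M (val i' j)
  stamp_or : ∀ j, M' (stamp i j) = M (stamp i j) ∨ M' (stamp i j) = h

theorem Frame.refl (i : Fin L) (h : Word w) (M : Mem w (numCells L c)) : Frame i h M M :=
  ⟨rfl, fun _ _ _ => rfl, fun _ _ _ => rfl, fun _ => Or.inl rfl⟩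

theorem Frame.trans {i : Fin L} {h : Word w} {M M' M'' : Mem w (numCells L c)}
    (h₁ : Frame i h M M') (h₂ : Frame i h M' M'') : Frame i h M M'' where
  clk_eq := h₂.clk_eq.trans h₁.clk_eq
  stamp_eq i' hi j := (h₂.stamp_eq i' hi j).trans (h₁.stamp_eq i' hi j)
  val_eq i' hi j := (h₂.val_eq i' hi j).trans (h₁.val_eq i' hi j)
  stamp_or j := by
    rcases h₂.stamp_or j with e | e
    · rw [e]; exact h₁.stamp_or j
    · exact Or.inr e

theorem Frame.view_eq {i : Fin L} {h : Word w} {M M' : Mem w (numCells L c)}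
    (hM : Frame i h M M') {i' : Fin L} (hi : i' ≠ i) (h' : Word w) :
    view M' i' h' = view M i' h' := by
  funext j
  simp only [view, hM.stamp_eq i' hi, hM.val_eq i' hi]

theorem frame_write (i : Fin L) (h : Word w) (M : Mem w (numCells L c)) (j : Fin c) (x : Word w) :
    Frame i h M (Function.update (Function.update M (stamp i j) h) (val i j) x) where
  clk_eq := by simp [clk, stamp, val]
  stamp_eq i' hi j' := by simp [stamp, val, hi]
  val_eq i' hi j' := by simp [stamp, val, hi]
  stamp_or j' := by
    by_cases e : j' = j <;> simp [stamp, val, e]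

theorem view_write (i : Fin L) (h : Word w) (M : Mem w (numCells L c)) (j : Fin c) (x : Word w) :
    view (Function.update (Function.update M (stamp i j) h) (val i j) x) i h
      = Function.update (view M i h) j x := by
  funext j'
  by_cases e : j' = j
  · simp [view, stamp, val, e]
  · simp only [view, Function.update_of_ne e]
    rw [Function.update_of_ne (by simp [stamp, val]), Function.update_of_ne (by simp [stamp, e]),
      Function.update_of_ne (by simp [val, e]), Function.update_of_ne (by simp [stamp, val])]

/-- The simulation acts on the view exactly as the program acts on its memory. Only an inequality is
stated because the postcondition is controlled only on memories that the frame relation allows. -/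
theorem wp_virt_le (i : Fin L) (h : Word w) (p : Prog w c O)
    (Φ : O × Mem w (numCells L c) → ℝ≥0∞) (φ : O × Mem w c → ℝ≥0∞) (M : Mem w (numCells L c))
    (hΦ : ∀ o M', Frame i h M M' → Φ (o, M') ≤ φ (o, view M' i h)) :
    (virt i h p).wp Φ M ≤ p.wp φ (view M i h) := by
  induction p generalizing M with
  | ret o => exact hΦ o M (Frame.refl i h M)
  | read j k ih =>
    simp only [virt, wp, view]
    split_ifs with e
    · exact ih _ M hΦ
    · exact ih _ M hΦ
  | write j x p ih =>
    simp only [virt, wp]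
    rw [← view_write]
    exact ih _ fun o M' hM' => hΦ o M' ((frame_write i h M j x).trans hM')
  | rand k ih =>
    simp only [virt, wp]
    exact expect_mono _ fun x => ih x M hΦ

theorem cost_virt_le (i : Fin L) (h : Word w) (p : Prog w c O) :
    (virt i h p).cost ≤ 2 * p.cost := by
  induction p with
  | ret o => simp [virt, cost]
  | read j k ih =>
    simp only [virt, cost]
    have hs : ∀ x, (virt i h (k x)).cost ≤ 2 * Finset.univ.sup fun x => (k x).cost := fun x =>
      (ih x).trans (by gcongr; exact Finset.le_sup (f := fun x => (k x).cost) (Finset.mem_univ x))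
    have : (Finset.univ.sup fun x => (if x = h then read (val i j) fun y => virt i h (k y)
        else virt i h (k (zeroWord w))).cost) ≤ 1 + 2 * Finset.univ.sup fun x => (k x).cost := by
      refine Finset.sup_le fun x _ => ?_
      split_ifs
      · simp only [cost]
        gcongr
        exact Finset.sup_le fun x _ => hs x
      · exact (hs _).trans (by omega)
    omega
  | write j x p ih => simp only [virt, cost]; omega
  | rand k ih =>
    simp only [virt, cost]
    have : (Finset.univ.sup fun x => (virt i h (k x)).cost)
        ≤ 2 * Finset.univ.sup fun x => (k x).cost :=
      Finset.sup_le fun x _ => (ih x).trans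
        (by gcongr; exact Finset.le_sup (f := fun x => (k x).cost) (Finset.mem_univ x))
    omega

/-- The control states of the simulation that belong to one control state of the simulated
program. -/
def virtState (i : Fin L) (h : Word w) : Prog w c O → Bool → Prog w (numCells L c) O
  | read j k, true => read (val i j) fun y => virt i h (k y)
  | write j x p, true => write (val i j) x (virt i h p)
  | p, _ => virt i h p

/-- A simulated access takes two real steps, first the stamp and then the value, so the Boolean
telling which of them is next doubles the number of states. -/
theorem residuals_virt_subset (i : Fin L) (h : Word w) (p : Prog w c O)
    {T : Set (Prog w (numCells L c) O)} (hT : ∀ r ∈ p.residuals, ∀ b, virtState i h r b ∈ T) :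
    (virt i h p).residuals ⊆ T := by
  induction p with
  | ret o =>
    simpa [virt, residuals, virtState] using hT (ret o) (mem_residuals_self _) false
  | read j k ih =>
    have h₀ := hT _ (mem_residuals_self _)
    have hk : ∀ x, (virt i h (k x)).residuals ⊆ T := fun x => ih x fun r hr b =>
      hT r (Set.mem_insert_of_mem _ (Set.mem_iUnion.2 ⟨x, hr⟩)) b
    simp only [virt, residuals, Set.insert_subset_iff, Set.iUnion_subset_iff]
    refine ⟨h₀ false, fun x => ?_⟩
    split_ifs
    · simp only [residuals, Set.insert_subset_iff, Set.iUnion_subset_iff]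
      exact ⟨h₀ true, hk⟩
    · exact hk _
  | write j x p ih =>
    have h₀ := hT _ (mem_residuals_self _)
    simp only [virt, residuals, Set.insert_subset_iff]
    exact ⟨h₀ false, h₀ true, ih fun r hr b => hT r (Set.mem_insert_of_mem _ hr) b⟩
  | rand k ih =>
    have h₀ := hT _ (mem_residuals_self _)
    simp only [virt, residuals, Set.insert_subset_iff, Set.iUnion_subset_iff]
    exact ⟨h₀ false, fun x => ih x fun r hr b =>
      hT r (Set.mem_insert_of_mem _ (Set.mem_iUnion.2 ⟨x, hr⟩)) b⟩

/-- This confines the values collected from the copies to those returned by the original program, a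
finite set that can be counted. -/
theorem ret_mem_residuals_of_virt {i : Fin L} {h : Word w} {p : Prog w c O} {o : O}
    (ho : ret o ∈ (virt i h p).residuals) : ret o ∈ p.residuals := by
  have key : (virt i h p).residuals ⊆ {x | ∀ o, x = ret o → ret o ∈ p.residuals} := by
    refine residuals_virt_subset i h p ?_
    rintro r hr b o' e
    cases r <;> cases b <;> simp [virtState, virt] at e
    all_goals exact e ▸ hr
  exact key ho o rfl

/-! ### Loops over the slots -/

/-- Read the headers of the slots in the list. -/
def readHdrs (k : (Fin L → Word w) → Prog w (numCells L c) O) :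
    List (Fin L) → (Fin L → Word w) → Prog w (numCells L c) O
  | [], acc => k acc
  | i :: l, acc => read (hdr i) fun x => readHdrs k l (Function.update acc i x)

/-- Write the headers of the slots in the list. -/
def writeHdrs (h : Fin L → Word w) (p : Prog w (numCells L c) O) :
    List (Fin L) → Prog w (numCells L c) O
  | [] => p
  | i :: l => write (hdr i) (h i) (writeHdrs h p l)

/-- Simulate the program `p` on the slots in the list, and collect the returned values. -/
def runSlots (p : Prog w c O) (h : Fin L → Word w) (k : (Fin L → O) → Prog w (numCells L c) O') :
    List (Fin L) → (Fin L → O) → Prog w (numCells L c) O'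
  | [], acc => k acc
  | i :: l, acc => (virt i (h i) p).bind fun o => runSlots p h k l (Function.update acc i o)

theorem wp_readHdrs (k : (Fin L → Word w) → Prog w (numCells L c) O)
    (Φ : O × Mem w (numCells L c) → ℝ≥0∞) (M : Mem w (numCells L c)) (l : List (Fin L))
    (acc : Fin L → Word w) (hacc : ∀ i, i ∉ l → acc i = M (hdr i)) :
    (readHdrs k l acc).wp Φ M = (k fun i => M (hdr i)).wp Φ M := by
  induction l generalizing acc with
  | nil =>
    have : acc = fun i => M (hdr i) := funext fun i => hacc i (by simp)
    rw [readHdrs, this]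
  | cons i l ih =>
    rw [readHdrs, wp]
    refine ih _ fun i' hi' => ?_
    by_cases e : i' = i
    · subst e; simp
    · rw [Function.update_of_ne e]
      exact hacc i' (by simp [e, hi'])

theorem wp_writeHdrs_le (h : Fin L → Word w) (p : Prog w (numCells L c) O)
    (Φ : O × Mem w (numCells L c) → ℝ≥0∞) (C : ℝ≥0∞) (M : Mem w (numCells L c))
    (l : List (Fin L))
    (hp : ∀ M', (∀ i ∈ l, M' (hdr i) = h i) → (∀ x, (∀ i ∈ l, x ≠ hdr i) → M' x = M x) →
      p.wp Φ M' ≤ C) :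
    (writeHdrs h p l).wp Φ M ≤ C := by
  induction l generalizing M with
  | nil => exact hp M (by simp) (by simp)
  | cons i l ih =>
    rw [writeHdrs, wp]
    refine ih _ fun M' h₁ h₂ => hp M' ?_ ?_
    · intro i' hi'
      by_cases e : i' ∈ l
      · exact h₁ i' e
      · have : i' = i := by simpa [e] using hi'
        subst this
        rw [h₂ (hdr i') fun j hj hij => e ?_]
        · simp
        · have : i' = j := by simpa [hdr] using hij
          exact this ▸ hj
    · intro x hx
      rw [h₂ x fun j hj => hx j (by simp [hj]), Function.update_of_ne (hx i (by simp))]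

/-- `M` can arise from `M₀` by simulating programs on the slots with headers `h`. -/
structure Extends (h : Fin L → Word w) (M₀ M : Mem w (numCells L c)) : Prop where
  clk_eq : M clk = M₀ clk
  stamp_or : ∀ i j, M (stamp i j) = M₀ (stamp i j) ∨ M (stamp i j) = h i

theorem Extends.frame {h : Fin L → Word w} {M₀ M M' : Mem w (numCells L c)} {i : Fin L}
    (hM : Extends h M₀ M) (hF : Frame i (h i) M M') : Extends h M₀ M' where
  clk_eq := hF.clk_eq.trans hM.clk_eq
  stamp_or i' j := by
    by_cases e : i' = i
    · subst e
      rcases hF.stamp_or j with e | e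
      · rw [e]; exact hM.stamp_or i' j
      · exact Or.inr e
    · rw [hF.stamp_eq i' e j]; exact hM.stamp_or i' j

/-- A postcondition that is a sum over the slots can be pulled back slot by slot: running one copy
leaves the views of all others unchanged, so their terms are constants for it. The copies may share
the memory and nothing is said about independence. -/
theorem wp_runSlots_le (p : Prog w c O) (h : Fin L → Word w)
    (k : (Fin L → O) → Prog w (numCells L c) O') (Φ : O' × Mem w (numCells L c) → ℝ≥0∞)
    (g : Fin L → O × Mem w c → ℝ≥0∞) (C : ℝ≥0∞) (M₀ : Mem w (numCells L c))
    (hk : ∀ acc M, Extends h M₀ M →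
      (k acc).wp Φ M ≤ ∑ i, g i (acc i, view M i (h i)) + C)
    (l : List (Fin L)) (hl : l.Nodup) (acc : Fin L → O) (M : Mem w (numCells L c))
    (hM : Extends h M₀ M) :
    (runSlots p h k l acc).wp Φ M
      ≤ ∑ i, (if i ∈ l then p.wp (g i) (view M i (h i)) else g i (acc i, view M i (h i))) + C := by
  induction l generalizing acc M with
  | nil => simpa [runSlots] using hk acc M hM
  | cons i l ih =>
    obtain ⟨hil, hl⟩ := List.nodup_cons.1 hl
    rw [runSlots, wp_bind]
    -- The terms of the other slots, which the frame relation keeps constant while slot `i` runs.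
    set rest : ℝ≥0∞ := ∑ i' ∈ Finset.univ.erase i,
      (if i' ∈ i :: l then p.wp (g i') (view M i' (h i')) else g i' (acc i', view M i' (h i')))
      with hrest
    refine (wp_virt_le i (h i) p _ (fun y => g i y + (rest + C)) M ?_).trans ?_
    · intro o M' hM'
      refine (ih hl _ M' (hM.frame hM')).trans ?_
      rw [← Finset.add_sum_erase _ _ (Finset.mem_univ i)]
      simp only [hil, if_false, Function.update_self]
      rw [add_assoc]
      gcongr
      rw [hrest]
      refine Finset.sum_le_sum fun i' hi' => le_of_eq ?_
      have hne : i' ≠ i := Finset.ne_of_mem_erase hi'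
      simp only [List.mem_cons, hne, false_or, Function.update_of_ne hne,
        hM'.view_eq hne]
    · rw [wp_add, wp_const, ← Finset.add_sum_erase _ _ (Finset.mem_univ i), ← hrest]
      simp [add_assoc]

theorem cost_readHdrs_le (k : (Fin L → Word w) → Prog w (numCells L c) O) {C : ℕ}
    (hk : ∀ acc, (k acc).cost ≤ C) (l : List (Fin L)) (acc : Fin L → Word w) :
    (readHdrs k l acc).cost ≤ l.length + C := by
  induction l generalizing acc with
  | nil => simpa [readHdrs] using hk acc
  | cons i l ih =>
    have : (readHdrs k (i :: l) acc).cost ≤ 1 + (l.length + C) := by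
      simp only [readHdrs, cost]
      gcongr
      exact Finset.sup_le fun x _ => ih _
    simp only [List.length_cons]
    omega

theorem cost_writeHdrs (h : Fin L → Word w) (p : Prog w (numCells L c) O) (l : List (Fin L)) :
    (writeHdrs h p l).cost = l.length + p.cost := by
  induction l with
  | nil => simp [writeHdrs]
  | cons i l ih => simp only [writeHdrs, cost, ih, List.length_cons]; omega

theorem cost_runSlots_le (p : Prog w c O) (h : Fin L → Word w)
    (k : (Fin L → O) → Prog w (numCells L c) O') {C : ℕ} (hk : ∀ acc, (k acc).cost ≤ C)
    (l : List (Fin L)) (acc : Fin L → O) :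
    (runSlots p h k l acc).cost ≤ l.length * (2 * p.cost) + C := by
  induction l generalizing acc with
  | nil => simpa [runSlots] using hk acc
  | cons i l ih =>
    have h₁ := cost_bind_le (virt i (h i) p)
      (fun o => runSlots p h k l (Function.update acc i o)) fun o => ih _
    have h₂ := cost_virt_le i (h i) p
    simp only [runSlots, List.length_cons, add_mul, one_mul]
    omega

theorem residuals_readHdrs_subset (k : (Fin L → Word w) → Prog w (numCells L c) O)
    {T : Set (Prog w (numCells L c) O)} (l : List (Fin L))
    (hT : ∀ l', l' <:+ l → ∀ acc, readHdrs k l' acc ∈ T) (hk : ∀ acc, (k acc).residuals ⊆ T)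
    (acc : Fin L → Word w) : (readHdrs k l acc).residuals ⊆ T := by
  induction l generalizing acc with
  | nil => exact hk acc
  | cons i l ih =>
    simp only [readHdrs, residuals, Set.insert_subset_iff, Set.iUnion_subset_iff]
    exact ⟨hT _ List.suffix_rfl acc, fun x =>
      ih (fun l' hl' => hT l' (hl'.trans (List.suffix_cons i l))) _⟩

theorem residuals_writeHdrs_subset (h : Fin L → Word w) (p : Prog w (numCells L c) O)
    {T : Set (Prog w (numCells L c) O)} (l : List (Fin L))
    (hT : ∀ l', l' <:+ l → writeHdrs h p l' ∈ T) (hp : p.residuals ⊆ T) :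
    (writeHdrs h p l).residuals ⊆ T := by
  induction l with
  | nil => exact hp
  | cons i l ih =>
    simp only [writeHdrs, residuals, Set.insert_subset_iff]
    exact ⟨hT _ List.suffix_rfl, ih fun l' hl' => hT l' (hl'.trans (List.suffix_cons i l))⟩

theorem residuals_runSlots_subset (p : Prog w c O) (h : Fin L → Word w)
    (k : (Fin L → O) → Prog w (numCells L c) O') {T : Set (Prog w (numCells L c) O')} (V : Set O)
    (hV : ∀ o, ret o ∈ p.residuals → o ∈ V) (l : List (Fin L))
    (hT : ∀ i l', i :: l' <:+ l → ∀ acc : Fin L → O, (∀ i, acc i ∈ V) → ∀ r ∈ p.residuals, ∀ b,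
      ((virtState i (h i) r b).bind fun o => runSlots p h k l' (Function.update acc i o)) ∈ T)
    (hk : ∀ acc : Fin L → O, (∀ i, acc i ∈ V) → (k acc).residuals ⊆ T)
    (acc : Fin L → O) (hacc : ∀ i, acc i ∈ V) : (runSlots p h k l acc).residuals ⊆ T := by
  induction l generalizing acc with
  | nil => exact hk acc hacc
  | cons i l ih =>
    rw [runSlots]
    refine residuals_bind_subset _ _ ?_ ?_
    · exact fun r hr => residuals_virt_subset i (h i) p
        (T := {r | (r.bind fun o => runSlots p h k l (Function.update acc i o)) ∈ T})
        (fun r hr b => hT i l List.suffix_rfl acc hacc r hr b) hr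
    · intro o ho
      refine ih (fun i' l' hl' => hT i' l' (hl'.trans (List.suffix_cons i l))) _ fun i' => ?_
      by_cases e : i' = i
      · subst e
        simpa using hV o (ret_mem_residuals_of_virt ho)
      · simpa [Function.update_of_ne e] using hacc i'

end Prog

end DPHist

end

noncomputable section

namespace DPHist

/-! ### The histogram machine: time and space -/

/-- The decisions of the machine: `alloc` sets the headers at the beginning of an update, given the
time and the old headers; `prune` sets them at the end of the update, given the values returned by
the copies; `res` is the output. -/
structure Policy (w L : ℕ) (O : Type) where
  alloc : Word w → (Fin L → Word w) → Fin L → Word w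
  prune : (Fin L → Word w) → (Fin L → ℝ) → Fin L → Word w
  res : Word w → (Fin L → Word w) → (Fin L → ℝ) → O

namespace Policy

open Prog

variable {w c L : ℕ} {O : Type} (P : Policy w L O)

/-- The last phase of an update: write the headers and return. -/
def finish (c : ℕ) (x : Word w) (h : Fin L → Word w) (l : List (Fin L)) (o : Fin L → ℝ) :
    Prog w (numCells L c) O :=
  writeHdrs (P.prune h o) (ret (P.res x h o)) l

/-- The phase of an update in which the copies are executed. -/
def simulate (p : Prog w c ℝ) (x : Word w) (h : Fin L → Word w) (l : List (Fin L))
    (acc : Fin L → ℝ) : Prog w (numCells L c) O :=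
  runSlots p h (P.finish c x h (List.finRange L)) l acc

/-- The phase of an update that begins with reading the headers. -/
def load (p : Prog w c ℝ) (x : Word w) (l : List (Fin L)) (acc : Fin L → Word w) :
    Prog w (numCells L c) O :=
  readHdrs (fun h => P.simulate p x (P.alloc x h) (List.finRange L) 0) l acc

/-- The program executed on an update on which the copies execute `p`. -/
def update (p : Prog w c ℝ) : Prog w (numCells L c) O :=
  read clk fun x => write clk (succWord x)
    (P.load p (succWord x) (List.finRange L) fun _ => zeroWord w)

theorem cost_update_le (p : Prog w c ℝ) :
    (P.update p).cost ≤ 2 + 2 * L + L * (2 * p.cost) := by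
  have h₁ : ∀ x h, ∀ acc, (P.simulate p x h (List.finRange L) acc).cost
      ≤ L * (2 * p.cost) + L := fun x h acc => by
    refine (cost_runSlots_le p h _ (C := L) (fun o => ?_) _ acc).trans (by simp)
    simp [finish, cost_writeHdrs, cost]
  have h₂ : ∀ x acc, (P.load p x (List.finRange L) acc).cost ≤ L + (L * (2 * p.cost) + L) :=
    fun x acc => (cost_readHdrs_le _ (fun h => h₁ _ _ _) _ acc).trans (by simp)
  have h₃ : (P.update p).cost ≤ 1 + (1 + (L + (L * (2 * p.cost) + L))) := by
    simp only [update, cost]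
    gcongr
    exact Finset.sup_le fun x _ => by gcongr; exact h₂ _ _
  omega

/-- An index set for the control states of the machine: the phase, the program of the update, the
control state of a simulated copy, the time, the headers, the number of slots that the current loop
has dealt with, and the returned values. -/
abbrev Control (w L : ℕ) (Q : Set (Prog w c ℝ)) (V : Set ℝ) : Type :=
  Fin 5 × Q × Q × Bool × Word w × (Fin L → Word w) × Fin (L + 1) × (Fin L → V)

/-- The control state with a given index. -/
def control (Q : Set (Prog w c ℝ)) (V : Set ℝ) : Control w L Q V → Prog w (numCells L c) O
  | (0, p, _, _, _, _, _, _) => P.update p.1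
  | (1, p, _, _, x, _, _, _) => write clk x (P.load p.1 x (List.finRange L) fun _ => zeroWord w)
  | (2, p, _, _, x, h, j, _) => P.load p.1 x ((List.finRange L).drop j) h
  | (3, p, r, b, x, h, j, o) =>
    match (List.finRange L).drop j with
    | [] => P.update p.1
    | i :: l => (virtState i (h i) r.1 b).bind fun v =>
        P.simulate p.1 x h l (Function.update (fun i => (o i : ℝ)) i v)
  | (4, _, _, _, x, h, j, o) => P.finish c x h ((List.finRange L).drop j) fun i => (o i : ℝ)

theorem exists_drop_of_suffix {l : List (Fin L)} (hl : l <:+ List.finRange L) :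
    ∃ j : Fin (L + 1), (List.finRange L).drop j = l := by
  refine ⟨⟨L - l.length, by omega⟩, ?_⟩
  have := List.suffix_iff_eq_drop.1 hl
  simpa using this.symm

theorem residuals_update_subset (Q : Set (Prog w c ℝ)) (V : Set ℝ) (hV : ∀ o, ret o ∈ Q → o ∈ V)
    (hV₀ : (0 : ℝ) ∈ V) (p : Prog w c ℝ) (hp : p.residuals ⊆ Q) :
    (P.update p).residuals ⊆ Set.range (P.control Q V) := by
  have hpQ : p ∈ Q := hp (mem_residuals_self p)
  set T := Set.range (P.control Q V) with hT
  -- Dummy entries for the components of the index that the current phase ignores.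
  let v₀ : Fin L → V := fun _ => ⟨0, hV₀⟩
  let h₀ : Fin L → Word w := fun _ => zeroWord w
  have hfin : ∀ x h l, l <:+ List.finRange L → ∀ o : Fin L → ℝ, (∀ i, o i ∈ V) →
      P.finish c x h l o ∈ T := fun x h l hl o ho => by
    obtain ⟨j, rfl⟩ := exists_drop_of_suffix hl
    exact ⟨(4, ⟨p, hpQ⟩, ⟨p, hpQ⟩, true, x, h, j, fun i => ⟨o i, ho i⟩), rfl⟩
  have hsim : ∀ x h, (P.simulate p x h (List.finRange L) 0).residuals ⊆ T := fun x h => by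
    refine residuals_runSlots_subset p h _ V (fun o ho => hV o (hp ho)) _ ?_ ?_ _ fun _ => hV₀
    · intro i l hl acc hacc r hr b
      obtain ⟨j, hj⟩ := exists_drop_of_suffix hl
      refine ⟨(3, ⟨p, hpQ⟩, ⟨r, hp hr⟩, b, x, h, j, fun i => ⟨acc i, hacc i⟩), ?_⟩
      simp only [control]
      split
      · rename_i h'; simp [hj] at h'
      · rename_i i' l' h'
        rw [hj] at h'
        obtain ⟨rfl, rfl⟩ := List.cons.inj h'
        rfl
    · intro acc hacc
      refine residuals_writeHdrs_subset _ _ _ (fun l hl => hfin x h l hl acc hacc) ?_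
      simpa [residuals, finish, writeHdrs] using hfin x h [] (List.nil_suffix) acc hacc
  have hload : ∀ x, (P.load p x (List.finRange L) h₀).residuals ⊆ T := fun x => by
    refine residuals_readHdrs_subset _ _ (fun l hl acc => ?_) (fun acc => hsim _ _) _
    obtain ⟨j, rfl⟩ := exists_drop_of_suffix hl
    exact ⟨(2, ⟨p, hpQ⟩, ⟨p, hpQ⟩, true, x, acc, j, v₀), rfl⟩
  simp only [update, residuals, Set.insert_subset_iff, Set.iUnion_subset_iff]
  exact ⟨⟨(0, ⟨p, hpQ⟩, ⟨p, hpQ⟩, true, zeroWord w, h₀, 0, v₀), rfl⟩,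
    fun x => ⟨⟨(1, ⟨p, hpQ⟩, ⟨p, hpQ⟩, true, succWord x, h₀, 0, v₀), rfl⟩, hload _⟩⟩

/-- The streaming algorithm that simulates `A` on the slots. -/
def alg {U : Type} (A : StreamAlg w U ℝ) : StreamAlg w U O where
  cells := numCells L A.cells
  step u := P.update (A.step u)

theorem numCells_eq (L c : ℕ) : numCells L c = 1 + L + 2 * L * c := by
  simp only [numCells, Loc, Fintype.card_sum, Fintype.card_prod, Fintype.card_fin,
    Fintype.card_unit]
  ring

/-- With `R` control states of `A`, a state of the machine consists of a phase, two states of `A`, a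
bit, `L + 1` words, a loop counter and `L` returned values. Each returned value is one of at most `2
* R`, so the logarithm is `O(L * (w + log R))`. -/
theorem spaceBits_alg_le_of_nonempty {U : Type} [Finite U] [Nonempty U] (A : StreamAlg w U ℝ) :
    (P.alg A).spaceBits ≤ (4 * L + 2) * A.spaceBits + (2 * L + 2) * w + 3 * L + 4 := by
  set Q : Set (Prog w A.cells ℝ) := ⋃ u, (A.step u).residuals with hQ
  have hQfin : Q.Finite := Set.finite_iUnion fun u => finite_residuals _
  have hQne : Q.Nonempty := by
    obtain ⟨u⟩ := ‹Nonempty U›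
    exact ⟨A.step u, Set.mem_iUnion.2 ⟨u, mem_residuals_self _⟩⟩
  set V : Set ℝ := insert 0 {o | ret o ∈ Q} with hV
  have hinj : Function.Injective (fun o : ℝ => (ret o : Prog w A.cells ℝ)) :=
    fun o o' h => Prog.ret.inj h
  have hV' : {o : ℝ | (ret o : Prog w A.cells ℝ) ∈ Q}.Finite := hQfin.preimage hinj.injOn
  have hVfin : V.Finite := hV'.insert 0
  have : Finite Q := hQfin
  have : Finite V := hVfin
  set R := Q.ncard with hR
  have hR1 : 1 ≤ R := (Set.ncard_pos hQfin).2 hQne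
  have hVR : V.ncard ≤ 2 * R := by
    have h₁ : V.ncard ≤ {o : ℝ | (ret o : Prog w A.cells ℝ) ∈ Q}.ncard + 1 :=
      Set.ncard_insert_le _ _
    have h₂ : {o : ℝ | (ret o : Prog w A.cells ℝ) ∈ Q}.ncard ≤ R :=
      Set.ncard_le_ncard_of_injOn (fun o => ret o) (fun o ho => ho) hinj.injOn hQfin
    omega
  have hsub : (⋃ u, ((P.alg A).step u).residuals) ⊆ Set.range (P.control Q V) :=
    Set.iUnion_subset fun u => P.residuals_update_subset Q V
      (fun o ho => Set.mem_insert_of_mem _ ho) (Set.mem_insert _ _) _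
      (Set.subset_iUnion (fun u => (A.step u).residuals) u)
  have hcard : (⋃ u, ((P.alg A).step u).residuals).ncard
      ≤ 16 * R ^ 2 * 2 ^ w * (2 ^ w) ^ L * 2 ^ L * (2 * R) ^ L := by
    calc _ ≤ (Set.range (P.control Q V)).ncard := Set.ncard_le_ncard hsub (Set.finite_range _)
      _ ≤ Nat.card (Control w L Q V) := by
        rw [← Nat.card_coe_set_eq]
        exact Finite.card_range_le _
      _ = 5 * (R * (R * (2 * (2 ^ w * ((2 ^ w) ^ L * ((L + 1) * V.ncard ^ L)))))) := by
        simp [Control, Nat.card_prod, Nat.card_fun, hR]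
      _ = 10 * R ^ 2 * 2 ^ w * (2 ^ w) ^ L * (L + 1) * V.ncard ^ L := by ring
      -- Rounding `10` up to `16` and `L + 1` up to `2 ^ L` leaves a product whose logarithm is
      -- computed exactly.
      _ ≤ 16 * R ^ 2 * 2 ^ w * (2 ^ w) ^ L * 2 ^ L * (2 * R) ^ L := by
        gcongr
        · norm_num
        · exact Nat.lt_two_pow_self
  have hlog : Real.logb 2 ((⋃ u, ((P.alg A).step u).residuals).ncard : ℝ)
      ≤ 4 + 2 * Real.logb 2 R + w + w * L + L + L * (1 + Real.logb 2 R) := by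
    have hRpos : (0 : ℝ) < R := by exact_mod_cast hR1
    have e₁₆ : Real.logb 2 (16 : ℝ) = 4 := by
      rw [show (16 : ℝ) = 2 ^ 4 by norm_num, Real.logb_pow, Real.logb_self_eq_one (by norm_num)]
      norm_num
    have e : Real.logb 2 ((16 * R ^ 2 * 2 ^ w * (2 ^ w) ^ L * 2 ^ L * (2 * R) ^ L : ℕ) : ℝ)
        = 4 + 2 * Real.logb 2 R + w + w * L + L + L * (1 + Real.logb 2 R) := by
      push_cast
      rw [Real.logb_mul (by positivity) (by positivity), Real.logb_mul (by positivity) (by positivity),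
        Real.logb_mul (by positivity) (by positivity), Real.logb_mul (by positivity) (by positivity),
        Real.logb_mul (by positivity) (by positivity), ← pow_mul]
      simp only [Real.logb_pow, Real.logb_mul two_ne_zero hRpos.ne']
      rw [Real.logb_self_eq_one (by norm_num), e₁₆]
      push_cast
      ring
    rw [← e]
    rcases Nat.eq_zero_or_pos (⋃ u, ((P.alg A).step u).residuals).ncard with h0 | h0
    · rw [h0]
      simp only [Nat.cast_zero, Real.logb_zero]
      refine Real.logb_nonneg (by norm_num) ?_
      exact_mod_cast Nat.one_le_iff_ne_zero.2 (by positivity)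
    · exact Real.logb_le_logb_of_le (by norm_num) (by exact_mod_cast h0) (by exact_mod_cast hcard)
  have hRlog : 0 ≤ Real.logb 2 (R : ℝ) := Real.logb_nonneg (by norm_num) (by exact_mod_cast hR1)
  have hA : A.spaceBits = A.cells * w + Real.logb 2 R := rfl
  have hA' : (P.alg A).spaceBits = (1 + L + 2 * L * A.cells) * w
      + Real.logb 2 ((⋃ u, ((P.alg A).step u).residuals).ncard : ℝ) := by
    have : (((P.alg A).cells : ℕ) : ℝ) = 1 + L + 2 * L * A.cells := by
      rw [show (P.alg A).cells = numCells L A.cells from rfl, numCells_eq]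
      push_cast; ring
    rw [StreamAlg.spaceBits, this]
  have h1 : 0 ≤ (L : ℝ) * Real.logb 2 (R : ℝ) := by positivity
  have h2 : 0 ≤ (L : ℝ) * ((A.cells : ℝ) * w) := by positivity
  have h3 : 0 ≤ (A.cells : ℝ) * w := by positivity
  rw [hA', hA]
  nlinarith

theorem spaceBits_alg_le {U : Type} [Finite U] (A : StreamAlg w U ℝ) :
    (P.alg A).spaceBits ≤ (4 * L + 2) * A.spaceBits + (2 * L + 2) * w + 3 * L + 4 := by
  rcases isEmpty_or_nonempty U with hU | hU
  -- Without updates there are no control states, and the logarithm of `0` is `0` by convention.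
  · have h₁ : A.spaceBits = A.cells * w := by simp [StreamAlg.spaceBits]
    have h₂ : (P.alg A).spaceBits = (1 + L + 2 * L * A.cells) * w := by
      have : (((P.alg A).cells : ℕ) : ℝ) = 1 + L + 2 * L * A.cells := by
        rw [show (P.alg A).cells = numCells L A.cells from rfl, numCells_eq]
        push_cast; ring
      simp [StreamAlg.spaceBits, this]
    have h₃ : 0 ≤ (L : ℝ) * ((A.cells : ℝ) * w) := by positivity
    have h₄ : 0 ≤ (A.cells : ℝ) * w := by positivity
    have h₅ : 0 ≤ (L : ℝ) * w := by positivity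
    have h₆ : (0 : ℝ) ≤ w := by positivity
    have h₇ : (0 : ℝ) ≤ L := by positivity
    rw [h₁, h₂]
    nlinarith
  · exact P.spaceBits_alg_le_of_nonempty A

theorem updateTimeLE_alg {U : Type} (A : StreamAlg w U ℝ) {t : ℝ} (hA : A.UpdateTimeLE t) :
    (P.alg A).UpdateTimeLE ((4 * L + 3) * t) := by
  intro u
  have h₁ := P.cost_update_le (A.step u)
  have h₂ : (((P.update (A.step u)).cost : ℕ) : ℝ) ≤ 2 + 2 * L + L * (2 * (A.step u).cost) := by
    exact_mod_cast h₁
  have h₃ := hA u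
  push_cast at h₃ ⊢
  have h₄ : (((P.alg A).step u).cost : ℝ) = (P.update (A.step u)).cost := rfl
  have h₅ : (0 : ℝ) ≤ (A.step u).cost := by positivity
  have h₆ : (0 : ℝ) ≤ L := by positivity
  rw [h₄]
  nlinarith [mul_le_mul_of_nonneg_left h₃ h₆]

end Policy

end DPHist

end

noncomputable section

namespace DPHist

/-! ### Pruning a histogram -/

section prune

variable {ι : Type} [DecidableEq ι]

/-- `s'` arises from `s` by removing an index that lies between two others with almost the same
values. -/
def Removal (θ : ℝ) (t : ι → ℕ) (v : ι → ℝ) (s s' : Finset ι) : Prop :=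
  ∃ j ∈ s, s' = s.erase j ∧ ∃ i ∈ s', ∃ k ∈ s', t i < t j ∧ t j < t k ∧ θ * v i ≤ v k

/-- Each removal lowers the cardinality. The end result need not be unique: only that it is
reachable and that nothing more can be removed is used. -/
theorem exists_pruned (θ : ℝ) (t : ι → ℕ) (v : ι → ℝ) (s : Finset ι) :
    ∃ s', Relation.ReflTransGen (Removal θ t v) s s' ∧ ∀ s'', ¬ Removal θ t v s' s'' := by
  induction hn : s.card using Nat.strong_induction_on generalizing s with
  | _ n ih =>
    by_cases h : ∃ s'', Removal θ t v s s''
    · obtain ⟨s'', hs⟩ := h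
      obtain ⟨j, hj, e, -⟩ := id hs
      obtain ⟨s', h₁, h₂⟩ := ih s''.card (by rw [← hn, e]; exact Finset.card_erase_lt_of_mem hj) s'' rfl
      exact ⟨s', h₁.head hs, h₂⟩
    · exact ⟨s, .refl, fun s'' hs => h ⟨s'', hs⟩⟩

/-- Remove indices as long as possible. -/
def pruned (θ : ℝ) (t : ι → ℕ) (v : ι → ℝ) (s : Finset ι) : Finset ι :=
  (exists_pruned θ t v s).choose

theorem pruned_reach (θ : ℝ) (t : ι → ℕ) (v : ι → ℝ) (s : Finset ι) :
    Relation.ReflTransGen (Removal θ t v) s (pruned θ t v s) :=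
  (exists_pruned θ t v s).choose_spec.1

theorem not_removal_pruned (θ : ℝ) (t : ι → ℕ) (v : ι → ℝ) (s s' : Finset ι) :
    ¬ Removal θ t v (pruned θ t v s) s' :=
  (exists_pruned θ t v s).choose_spec.2 s'

theorem subset_of_reach {θ : ℝ} {t : ι → ℕ} {v : ι → ℝ} {s s' : Finset ι}
    (h : Relation.ReflTransGen (Removal θ t v) s s') : s' ⊆ s := by
  induction h with
  | refl => exact subset_rfl
  | tail _ h ih =>
    obtain ⟨j, -, rfl, -⟩ := h
    exact (Finset.erase_subset _ _).trans ih

theorem pruned_subset (θ : ℝ) (t : ι → ℕ) (v : ι → ℝ) (s : Finset ι) : pruned θ t v s ⊆ s :=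
  subset_of_reach (pruned_reach θ t v s)

/-- If values that are two apart decrease by the factor `θ`, then the values decrease
geometrically. -/
theorem exists_le_pow_mul {θ : ℝ} (hθ : 0 ≤ θ) {t : ι → ℕ} {v : ι → ℝ} (N : ℕ) (s : Finset ι)
    (hinj : Set.InjOn t s)
    (hs : ∀ i ∈ s, ∀ j ∈ s, ∀ k ∈ s, t i < t j → t j < t k → v k ≤ θ * v i)
    (hN : 2 * N + 1 ≤ s.card) (i : ι) (hi : i ∈ s) (himin : ∀ j ∈ s, t i ≤ t j) :
    ∃ k ∈ s, v k ≤ θ ^ N * v i := by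
  induction N generalizing s i with
  | zero => exact ⟨i, hi, by simp⟩
  | succ N ih =>
    have c₁ : (s.erase i).card = s.card - 1 := Finset.card_erase_of_mem hi
    obtain ⟨j, hj, hjmin⟩ := (s.erase i).exists_min_image t (Finset.card_pos.1 (by omega))
    have c₂ : ((s.erase i).erase j).card = s.card - 1 - 1 := by
      rw [Finset.card_erase_of_mem hj, c₁]
    obtain ⟨k, hk, hkmin⟩ := ((s.erase i).erase j).exists_min_image t
      (Finset.card_pos.1 (by omega))
    have hss : (s.erase i).erase j ⊆ s :=
      (Finset.erase_subset _ _).trans (Finset.erase_subset _ _)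
    have hjs : j ∈ s := Finset.mem_of_mem_erase hj
    have hks : k ∈ s := hss hk
    obtain ⟨l, hl, hle⟩ := ih ((s.erase i).erase j) (hinj.mono (by exact_mod_cast hss))
      (fun a ha b hb c hc => hs a (hss ha) b (hss hb) c (hss hc)) (by omega) k hk hkmin
    have hij : t i < t j := lt_of_le_of_ne (himin j hjs) fun e =>
      Finset.ne_of_mem_erase hj (hinj hi hjs e).symm
    have hjk : t j < t k := lt_of_le_of_ne (hjmin k (Finset.mem_of_mem_erase hk)) fun e =>
      Finset.ne_of_mem_erase hk (hinj hjs hks e).symm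
    refine ⟨l, hss hl, hle.trans ?_⟩
    rw [pow_succ, mul_assoc]
    gcongr
    exact hs i hi j hjs k hks hij hjk

/-- With `2 * N + 1` survivors the geometric decrease would force some value down to `θ ^ N * hi`,
below the lower bound `lo`. -/
theorem card_le_of_not_removal {θ lo hi : ℝ} (hθ : 0 ≤ θ) {t : ι → ℕ} {v : ι → ℝ} {N : ℕ}
    {s : Finset ι} (hinj : Set.InjOn t s) (hs : ∀ s', ¬ Removal θ t v s s')
    (hlo : ∀ i ∈ s, lo ≤ v i) (hhi : ∀ i ∈ s, v i ≤ hi) (hN : θ ^ N * hi < lo) :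
    s.card ≤ 2 * N := by
  by_contra! hc
  obtain ⟨i, his, himin⟩ := s.exists_min_image t (Finset.card_pos.1 (by omega))
  obtain ⟨k, hks, hk⟩ := exists_le_pow_mul (v := v) hθ N s hinj (fun i hi j hj k hk hij hjk => by
    by_contra! hlt
    exact hs _ ⟨j, hj, rfl, i, Finset.mem_erase.2 ⟨fun e => by simp [e] at hij, hi⟩, k,
      Finset.mem_erase.2 ⟨fun e => by simp [e] at hjk, hk⟩, hij, hjk, hlt.le⟩) hc i his himin
  have : θ ^ N * v i ≤ θ ^ N * hi := by gcongr; exact hhi i his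
  linarith [hlo k hks]

end prune

/-! ### Smooth functions and histograms -/

section smooth

variable {U : Type} {f : List U → ℝ} {m n q : ℕ} {ρ β a : ℝ}

theorem IsSmooth.drop_le (hf : IsSmooth f m n q ρ β) {l : List U} (hl : l.length ≤ m) {p p' : ℕ}
    (hpp : p ≤ p') (hp : p' < l.length) : f (l.drop p') ≤ f (l.drop p) := by
  refine hf.mono _ _ ?_ ?_ ?_
  · simpa using hp
  · obtain ⟨d, rfl⟩ := Nat.exists_eq_add_of_le hpp
    rw [← List.drop_drop]
    exact List.drop_suffix _ _
  · rw [List.length_drop]; omega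

theorem IsSmooth.one_le_drop (hf : IsSmooth f m n q ρ β) {l : List U} (hl : l.length ≤ m) {p : ℕ}
    (hp : p < l.length) : 1 ≤ f (l.drop p) :=
  hf.one_le _ (by simpa using hp) (by rw [List.length_drop]; omega)

/-- The starting position `t` covers the position `p` of the stream: at some moment since the
arrival of `p`, the suffixes starting at `t` and `p` had almost the same value. -/
def CoversAt (f : List U → ℝ) (β : ℝ) (σ : List U) (t p : ℕ) : Prop :=
  t ≤ p ∧ ∃ e, p < e ∧ e ≤ σ.length ∧
    (1 - β) * f ((σ.take e).drop t) ≤ f ((σ.take e).drop p)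

theorem CoversAt.append {σ : List U} {t p : ℕ} (h : CoversAt f β σ t p) (u : U) :
    CoversAt f β (σ ++ [u]) t p := by
  obtain ⟨h₁, e, h₂, h₃, h₄⟩ := h
  refine ⟨h₁, e, h₂, by simp; omega, ?_⟩
  rwa [List.take_append_of_le_length h₃]

theorem coversAt_self (hf : IsSmooth f m n q ρ β) {σ : List U} (hσ : σ.length ≤ m) {p : ℕ}
    (hp : p < σ.length) : CoversAt f β σ p p := by
  refine ⟨le_rfl, σ.length, hp, le_rfl, ?_⟩
  rw [List.take_length]
  nlinarith [hf.one_le_drop hσ hp, hf.pos]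

/-- At the moment `e` the two suffixes were `β`-close; the updates after `e` are a common
continuation, so smoothness keeps them `ρ`-close until now. -/
theorem CoversAt.smooth (hf : IsSmooth f m n q ρ β) {σ : List U} (hσ : σ.length ≤ m) {t p : ℕ}
    (h : CoversAt f β σ t p) : (1 - ρ) * f (σ.drop t) ≤ f (σ.drop p) := by
  obtain ⟨h₁, e, h₂, h₃, h₄⟩ := h
  have key : ∀ s, s < e → (σ.take e).drop s ++ σ.drop e = σ.drop s := fun s hs => by
    conv_rhs => rw [← List.take_append_drop e σ]
    rw [List.drop_append_of_le_length (by simp; omega)]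
  rw [← key t (by omega), ← key p h₂]
  refine hf.smooth _ _ _ ?_ ?_ ?_ h₄
  · simp; omega
  · obtain ⟨d, rfl⟩ := Nat.exists_eq_add_of_le h₁
    rw [← List.drop_drop]
    exact List.drop_suffix _ _
  · rw [key t (by omega), List.length_drop]; omega

/-- Every position of the stream is covered by one of the starting positions. -/
def Covers {ι : Type} (f : List U → ℝ) (β : ℝ) (σ : List U) (t : ι → ℕ) (s : Finset ι) : Prop :=
  ∀ p < σ.length, ∃ i ∈ s, CoversAt f β σ (t i) p

variable {ι : Type}

/-- `v` approximates `f` on all the suffixes that start at the given positions. -/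
def Accurate (f : List U → ℝ) (a : ℝ) (σ : List U) (t : ι → ℕ) (v : ι → ℝ) (s : Finset ι) : Prop :=
  ∀ i ∈ s, (1 - a) * f (σ.drop (t i)) ≤ v i ∧ v i ≤ (1 + a) * f (σ.drop (t i))

/-- Suppose `p` was covered by the removed start `j`, between `i` and `k`. If `k` starts at or
before `p`, then `k` covers `p` with the same past moment, because the suffix from `k` has a value
no larger than the one from `j`. Otherwise `p` precedes `k`, and the estimates that triggered the
removal show that `i` covers `p` at the present moment. -/
theorem Covers.removal [DecidableEq ι] (hf : IsSmooth f m n q ρ β) (hβ : β ≤ 1) (ha : 0 ≤ a)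
    (haβ : 4 * a ≤ β) {σ : List U} (hσ : σ.length ≤ m) {t : ι → ℕ} {v : ι → ℝ} {s s' : Finset ι}
    (ht : ∀ i ∈ s, t i < σ.length) (hv : Accurate f a σ t v s) (hc : Covers f β σ t s)
    (h : Removal (1 - β / 2) t v s s') : Covers f β σ t s' := by
  obtain ⟨j, hj, rfl, i, hi, k, hk, hij, hjk, hle⟩ := h
  have his := Finset.mem_of_mem_erase hi
  have hks := Finset.mem_of_mem_erase hk
  intro p hp
  obtain ⟨x, hx, hxp⟩ := hc p hp
  by_cases e : x = j
  · subst e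
    obtain ⟨h₁, e, h₂, h₃, h₄⟩ := hxp
    by_cases hkp : t k ≤ p
    · refine ⟨k, hk, hkp, e, h₂, h₃, le_trans ?_ h₄⟩
      have : f ((σ.take e).drop (t k)) ≤ f ((σ.take e).drop (t x)) :=
        hf.drop_le (by simp; omega) hjk.le (by simp; omega)
      exact mul_le_mul_of_nonneg_left this (by linarith)
    · refine ⟨i, hi, by omega, σ.length, hp, le_rfl, ?_⟩
      rw [List.take_length]
      have hkk : f (σ.drop (t k)) ≤ f (σ.drop p) := hf.drop_le hσ (by omega) (ht k hks)
      have h₅ := (hv i his).1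
      have h₆ := (hv k hks).2
      have f₁ := hf.one_le_drop hσ (ht i his)
      have f₂ := hf.one_le_drop hσ (ht k hks)
      refine le_trans ?_ hkk
      set F := f (σ.drop (t i))
      set G := f (σ.drop (t k))
      have h₇ : (1 - β / 2) * ((1 - a) * F) ≤ (1 + a) * G :=
        (mul_le_mul_of_nonneg_left h₅ (by linarith)).trans (hle.trans h₆)
      have h₈ : (1 + a) * ((1 - β) * F) ≤ (1 - β / 2) * ((1 - a) * F) := by
        -- This inequality dictates the constants: the threshold `1 - β / 2` together with two
        -- estimation errors `a ≤ β / 4` still certifies true closeness `1 - β`.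
        have : (1 + a) * (1 - β) ≤ (1 - β / 2) * (1 - a) := by nlinarith [hf.pos]
        nlinarith
      exact le_of_mul_le_mul_left (h₈.trans h₇) (by linarith)
  · exact ⟨x, Finset.mem_erase.2 ⟨e, hx⟩, hxp⟩

theorem Covers.pruned [DecidableEq ι] (hf : IsSmooth f m n q ρ β) (hβ : β ≤ 1) (ha : 0 ≤ a)
    (haβ : 4 * a ≤ β) {σ : List U} (hσ : σ.length ≤ m) {t : ι → ℕ} {v : ι → ℝ} {s : Finset ι}
    (ht : ∀ i ∈ s, t i < σ.length) (hv : Accurate f a σ t v s) (hc : Covers f β σ t s) :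
    Covers f β σ t (pruned (1 - β / 2) t v s) := by
  have h := pruned_reach (1 - β / 2) t v s
  generalize DPHist.pruned (1 - β / 2) t v s = s' at h ⊢
  induction h with
  | refl => exact hc
  | tail h₁ h₂ ih =>
    have hsub := subset_of_reach h₁
    exact ih.removal hf hβ ha haβ hσ (fun i hi => ht i (hsub hi)) (fun i hi => hv i (hsub hi)) h₂

theorem card_pruned_le [DecidableEq ι] (hf : IsSmooth f m n q ρ β) (hβ : β ≤ 1) (ha : a ≤ 1 / 2)
    {σ : List U} (hσ : σ.length ≤ m) {t : ι → ℕ} {v : ι → ℝ} {s : Finset ι}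
    (hinj : Set.InjOn t s) (ht : ∀ i ∈ s, t i < σ.length) (hv : Accurate f a σ t v s) {N : ℕ}
    (hN : (1 - β / 2) ^ N * (2 * (n : ℝ) ^ q) < 1 / 2) :
    (pruned (1 - β / 2) t v s).card ≤ 2 * N := by
  have hsub := pruned_subset (1 - β / 2) t v s
  refine card_le_of_not_removal (by linarith) (hinj.mono (by exact_mod_cast hsub))
    (not_removal_pruned _ t v s) (lo := 1 / 2) (hi := 2 * (n : ℝ) ^ q) ?_ ?_ hN
  · intro i hi
    have h₁ := (hv i (hsub hi)).1
    have h₂ := hf.one_le_drop hσ (ht i (hsub hi))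
    nlinarith
  · intro i hi
    have hlt := ht i (hsub hi)
    have h₁ := (hv i (hsub hi)).2
    have h₂ := hf.one_le_drop hσ hlt
    have h₃ : f (σ.drop (t i)) ≤ (n : ℝ) ^ q :=
      hf.bounded _ (by simpa using hlt) (by rw [List.length_drop]; omega)
    nlinarith

/-- The value at the last starting position that is not after `p` approximates the value at `p`. -/
theorem Covers.approx (hf : IsSmooth f m n q ρ β) (hρ : ρ ≤ 1 / 4) (ha : 0 ≤ a) (haβ : 4 * a ≤ β)
    {σ : List U} (hσ : σ.length ≤ m) {t : ι → ℕ} {v : ι → ℝ} {s : Finset ι}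
    (hv : Accurate f a σ t v s) (hc : Covers f β σ t s)
    {p : ℕ} (hp : p < σ.length) {i : ι} (hi : i ∈ s) (hip : t i ≤ p)
    (hmax : ∀ j ∈ s, t j ≤ p → t j ≤ t i) :
    (1 - 2 * ρ) * f (σ.drop p) ≤ v i ∧ v i ≤ (1 + 2 * ρ) * f (σ.drop p) := by
  -- The covering start `j` is not later than `i`, by maximality of `i`; so the value from `i` is
  -- squeezed between those from `p` and from `j`.
  obtain ⟨j, hj, hjp⟩ := hc p hp
  have h₁ := hjp.smooth hf hσ
  have h₂ : f (σ.drop (t i)) ≤ f (σ.drop (t j)) :=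
    hf.drop_le hσ (hmax j hj hjp.1) (by omega)
  have h₃ : f (σ.drop p) ≤ f (σ.drop (t i)) := hf.drop_le hσ hip hp
  have h₄ := hf.one_le_drop hσ hp
  obtain ⟨h₅, h₆⟩ := hv i hi
  have hβ := hf.le
  have hβ' := hf.pos
  set G := f (σ.drop p)
  set F := f (σ.drop (t i))
  constructor
  · nlinarith
  · have h₇ : (1 - ρ) * F ≤ G := (mul_le_mul_of_nonneg_left h₂ (by linarith)).trans h₁
    have h₈ : (1 - ρ) * ((1 + a) * F) ≤ (1 + a) * G := by nlinarith
    have h₉ : (1 + a) * G ≤ (1 - ρ) * ((1 + 2 * ρ) * G) := by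
      -- Here `a ≤ ρ / 4`, whereas `ρ ≤ 1 / 4` gives `ρ - 2 * ρ ^ 2 ≥ ρ / 2`.
      have : 1 + a ≤ (1 - ρ) * (1 + 2 * ρ) := by nlinarith
      nlinarith
    exact h₆.trans (le_of_mul_le_mul_left (h₈.trans h₉) (by linarith))

end smooth

end DPHist

end

noncomputable section

namespace DPHist

/-! ### The failure probability of a streaming algorithm -/

namespace StreamAlg

variable {w : ℕ} {U O : Type}

theorem exec_append_singleton (A : StreamAlg w U O) (σ : List U) (u : U) :
    A.exec (σ ++ [u]) = (A.exec σ).bind fun x =>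
      ((A.step u).run x.2).map fun y => (some y.1, y.2) := by
  simp [exec, List.foldl_append]

/-- The expectation of `bad` at the end of the stream, as a function of the state before the
remaining updates. -/
def future (A : StreamAlg w U O) (bad : Option O → ℝ≥0∞) :
    List U → Option O × Mem w A.cells → ℝ≥0∞
  | [], x => bad x.1
  | u :: τ, x => (A.step u).wp (fun y => A.future bad τ (some y.1, y.2)) x.2

theorem future_le_one (A : StreamAlg w U O) {bad : Option O → ℝ≥0∞} (hbad : ∀ o, bad o ≤ 1)
    (τ : List U) (x : Option O × Mem w A.cells) : A.future bad τ x ≤ 1 := by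
  induction τ generalizing x with
  | nil => exact hbad _
  | cons u τ ih =>
    exact (Prog.wp_mono _ (fun y => ih _) _).trans (Prog.wp_const _ _ _).le

theorem expect_outputLaw (A : StreamAlg w U O) (bad : Option O → ℝ≥0∞) (σ : List U) :
    expect (A.outputLaw σ) bad = A.future bad σ (none, zeroMem w A.cells) := by
  have key : ∀ (τ : List U) (μ : PMF (Option O × Mem w A.cells)),
      expect (τ.foldl (fun μ u => μ.bind fun x =>
        ((A.step u).run x.2).map fun y => (some y.1, y.2)) μ) (fun x => bad x.1)
        = expect μ (A.future bad τ) := by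
    intro τ
    induction τ with
    | nil => intro μ; rfl
    | cons u τ ih =>
      intro μ
      rw [List.foldl_cons, ih, expect_bind]
      congr 1
      funext x
      rw [expect_map, Prog.expect_run]
      rfl
  rw [outputLaw, expect_map, exec, key, expect_pure]

/-- The indicator of the event that the output `o` is not an approximation of `f η`. -/
def badOut (f : List U → ℝ) (a : ℝ) (η : List U) (o : ℝ) : ℝ≥0∞ :=
  open Classical in if (1 - a) * f η ≤ o ∧ o ≤ (1 + a) * f η then 0 else 1

/-- The expected number of bad outputs on the remaining updates, when the updates `η` have been
processed. -/
def futureBad (A : StreamAlg w U ℝ) (f : List U → ℝ) (a : ℝ) :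
    List U → List U → Mem w A.cells → ℝ≥0∞
  | [], _, _ => 0
  | u :: τ, η, V => (A.step u).wp
      (fun y => badOut f a (η ++ [u]) y.1 + A.futureBad f a τ (η ++ [u]) y.2) V

/-- Each remaining prefix is itself a stream on which `A` errs with probability at most `d`;
linearity of expectation adds these up. -/
theorem expect_futureBad_le (A : StreamAlg w U ℝ) {f : List U → ℝ} {m : ℕ} {a d : ℝ}
    (hA : A.IsApprox f m a d) (hd : 0 ≤ d) (hd' : d ≤ 1) (τ η : List U)
    (hm : η.length + τ.length ≤ m) :
    expect (A.exec η) (fun x => A.futureBad f a τ η x.2) ≤ τ.length * ENNReal.ofReal d := by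
  induction τ generalizing η with
  | nil => simp [futureBad, expect_const]
  | cons u τ ih =>
    simp only [List.length_cons] at hm
    set G : Set (Option ℝ) :=
      {o | ∃ v, o = some v ∧ (1 - a) * f (η ++ [u]) ≤ v ∧ v ≤ (1 + a) * f (η ++ [u])} with hG
    have h₁ : expect (A.exec η) (fun x => A.futureBad f a (u :: τ) η x.2)
        = expect (A.exec (η ++ [u])) (fun x => Gᶜ.indicator (fun _ => 1) x.1
          + A.futureBad f a τ (η ++ [u]) x.2) := by
      rw [exec_append_singleton, expect_bind]
      congr 1
      funext x
      rw [expect_map, Prog.expect_run, futureBad]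
      congr 1
      funext y
      congr 1
      simp only [badOut, Set.indicator, hG, Set.mem_compl_iff, Set.mem_ofPred_eq]
      by_cases hy : (1 - a) * f (η ++ [u]) ≤ y.1 ∧ y.1 ≤ (1 + a) * f (η ++ [u]) <;> simp [hy]
    have h₂ : expect (A.exec (η ++ [u])) (fun x => Gᶜ.indicator (fun _ => 1) x.1)
        ≤ ENNReal.ofReal d := by
      have e₁ := hA (η ++ [u]) (by simp) (by simp; omega)
      have e₂ := toOuterMeasure_add_compl (A.outputLaw (η ++ [u])) G
      have e₃ : expect (A.exec (η ++ [u])) (fun x => Gᶜ.indicator (fun _ => 1) x.1)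
          = (A.outputLaw (η ++ [u])).toOuterMeasure Gᶜ := by
        rw [← expect_indicator, outputLaw, expect_map]
      have e₄ : ENNReal.ofReal (1 - d) + ENNReal.ofReal d = 1 := by
        rw [← ENNReal.ofReal_add (by linarith) hd]; simp
      rw [e₃]
      by_contra! hlt
      have : ENNReal.ofReal (1 - d) + ENNReal.ofReal d
          < (A.outputLaw (η ++ [u])).toOuterMeasure G
            + (A.outputLaw (η ++ [u])).toOuterMeasure Gᶜ :=
        ENNReal.add_lt_add_of_le_of_lt ENNReal.ofReal_ne_top e₁ hlt
      rw [e₂, e₄] at this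
      exact lt_irrefl _ this
    rw [h₁, expect_add]
    refine (add_le_add h₂ (ih (η ++ [u]) (by simp; omega))).trans (le_of_eq ?_)
    simp only [List.length_cons]
    push_cast
    ring

/-- The expected number of bad outputs of copies that are started at each of the updates. -/
def birthsBad (A : StreamAlg w U ℝ) (f : List U → ℝ) (a : ℝ) : List U → ℝ≥0∞
  | [] => 0
  | u :: τ => A.futureBad f a (u :: τ) [] (zeroMem w A.cells) + A.birthsBad f a τ

/-- One birth per update and at most `m` outputs per birth. Every copy is charged for the whole rest
of the stream, whether or not it is pruned, so the random pruning decisions play no role. -/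
theorem birthsBad_le (A : StreamAlg w U ℝ) {f : List U → ℝ} {m : ℕ} {a d : ℝ}
    (hA : A.IsApprox f m a d) (hd : 0 ≤ d) (hd' : d ≤ 1) (τ : List U) (hm : τ.length ≤ m) :
    A.birthsBad f a τ ≤ τ.length * m * ENNReal.ofReal d := by
  induction τ with
  | nil => simp [birthsBad]
  | cons u τ ih =>
    have h₁ := A.expect_futureBad_le hA hd hd' (u :: τ) [] (by simpa using hm)
    have h₂ : A.futureBad f a (u :: τ) [] (zeroMem w A.cells) ≤ m * ENNReal.ofReal d := by
      simp only [exec, List.foldl_nil, expect_pure] at h₁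
      refine h₁.trans ?_
      gcongr
    have h₃ := ih (by simp only [List.length_cons] at hm; omega)
    refine (add_le_add h₂ h₃).trans (le_of_eq ?_)
    simp only [List.length_cons]
    push_cast
    ring

end StreamAlg

/-! ### The histogram policy -/

section policy

variable {w L : ℕ}

/-- The slots that are not free. -/
def alive (h : Fin L → Word w) : Finset (Fin L) := Finset.univ.filter fun i => (h i : ℕ) ≠ 0

theorem mem_alive {h : Fin L → Word w} {i : Fin L} : i ∈ alive h ↔ (h i : ℕ) ≠ 0 := by
  simp [alive]

/-- The position in the stream at which the copy in a slot has been started. -/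
def startPos (h : Fin L → Word w) (i : Fin L) : ℕ := (h i : ℕ) - 1

/-- The slot `i` holds the last copy that has been started at `p` or before. -/
def IsLast (h : Fin L → Word w) (p : ℕ) (i : Fin L) : Prop :=
  i ∈ alive h ∧ startPos h i ≤ p ∧
    ∀ j ∈ alive h, startPos h j ≤ p → startPos h j ≤ startPos h i

open Classical in
/-- Start a copy at every update, prune the histogram, and answer with the value of the last copy
started before the window. -/
def histPolicy (w L : ℕ) (θ : ℝ) (W : ℕ) (scale : ℝ → ℝ≥0) : Policy w L (ℝ × ℝ≥0) where
  alloc x h := if e : ∃ i, (h i : ℕ) = 0 then Function.update h e.choose x else h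
  prune h v i := if i ∈ pruned θ (startPos h) v (alive h) then h i else zeroWord w
  -- The truncated difference `x - W` is the first position of the window, and `0` while the stream
  -- is shorter than `W`. The pair `(0, 0)` is a default that a covering histogram never reaches.
  res x h v := if e : ∃ i, IsLast h (x - W) i then (v e.choose, scale (v e.choose)) else (0, 0)

theorem alive_prune (θ : ℝ) (W : ℕ) (scale : ℝ → ℝ≥0) (h : Fin L → Word w) (v : Fin L → ℝ) :
    alive ((histPolicy w L θ W scale).prune h v) = pruned θ (startPos h) v (alive h) := by
  ext i
  rw [mem_alive]
  by_cases hi : i ∈ pruned θ (startPos h) v (alive h)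
  · simpa [histPolicy, hi] using mem_alive.1 (pruned_subset _ _ _ _ hi)
  · simp [histPolicy, hi, zeroWord]

theorem prune_eq {θ : ℝ} {W : ℕ} {scale : ℝ → ℝ≥0} {h : Fin L → Word w} {v : Fin L → ℝ} {i : Fin L}
    (hi : i ∈ pruned θ (startPos h) v (alive h)) :
    (histPolicy w L θ W scale).prune h v i = h i := by
  simp [histPolicy, hi]

theorem exists_isLast {h : Fin L → Word w} {p : ℕ} (hex : ∃ i ∈ alive h, startPos h i ≤ p) :
    ∃ i, IsLast h p i := by
  obtain ⟨i, hi, hmax⟩ := ((alive h).filter fun i => startPos h i ≤ p).exists_max_image (startPos h)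
    (by obtain ⟨i, hi, hip⟩ := hex; exact ⟨i, by simp [hi, hip]⟩)
  rw [Finset.mem_filter] at hi
  exact ⟨i, hi.1, hi.2, fun j hj hjp => hmax j (by simp [hj, hjp])⟩

variable {U : Type}

/-- The headers describe a histogram of the stream `σ`. -/
structure IsHist (f : List U → ℝ) (β : ℝ) (σ : List U) (h : Fin L → Word w) : Prop where
  hdr_le : ∀ i, (h i : ℕ) ≤ σ.length
  inj : ∀ i ∈ alive h, ∀ j, h i = h j → i = j
  covers : Covers f β σ (startPos h) (alive h)

theorem IsHist.startPos_lt {f : List U → ℝ} {β : ℝ} {σ : List U} {h : Fin L → Word w}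
    (hh : IsHist f β σ h) {i : Fin L} (hi : i ∈ alive h) : startPos h i < σ.length := by
  have := hh.hdr_le i
  have := mem_alive.1 hi
  unfold startPos
  omega

theorem IsHist.injOn {f : List U → ℝ} {β : ℝ} {σ : List U} {h : Fin L → Word w}
    (hh : IsHist f β σ h) : Set.InjOn (startPos h) (alive h) := by
  intro i hi j hj e
  have h₁ := mem_alive.1 (Finset.mem_coe.1 hi)
  have h₂ := mem_alive.1 (Finset.mem_coe.1 hj)
  unfold startPos at e
  exact hh.inj i hi j (Fin.ext (by omega))

theorem alive_update {h : Fin L → Word w} {i₀ : Fin L} {x : Word w} (hx : (x : ℕ) ≠ 0) :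
    alive (Function.update h i₀ x) = insert i₀ (alive h) := by
  ext i
  rw [Finset.mem_insert, mem_alive, mem_alive]
  by_cases e : i = i₀
  · subst e; simpa using hx
  · simp [e]

/-- The new birth time exceeds every old header, which keeps headers distinct; the only new position
is covered by the new copy itself. -/
theorem IsHist.update {f : List U → ℝ} {m n q : ℕ} {ρ β : ℝ} (hf : IsSmooth f m n q ρ β)
    {σ : List U} {u : U} (hm : (σ ++ [u]).length ≤ m) {h : Fin L → Word w} (hh : IsHist f β σ h)
    {i₀ : Fin L} (hi₀ : (h i₀ : ℕ) = 0) {x : Word w} (hx : (x : ℕ) = σ.length + 1) :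
    IsHist f β (σ ++ [u]) (Function.update h i₀ x) where
  hdr_le i := by
    by_cases e : i = i₀
    · subst e; simp [hx]
    · have := hh.hdr_le i
      simp only [Function.update_of_ne e, List.length_append, List.length_singleton]
      omega
  inj i hi j e := by
    have hlt : ∀ k, h k ≠ x := fun k hk => by
      have := hh.hdr_le k
      rw [hk] at this
      omega
    by_cases ei : i = i₀ <;> by_cases ej : j = i₀
    · rw [ei, ej]
    · subst ei
      simp only [Function.update_self, Function.update_of_ne ej] at e
      exact absurd e.symm (hlt j)
    · subst ej
      simp only [Function.update_self, Function.update_of_ne ei] at e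
      exact absurd e (hlt i)
    · simp only [Function.update_of_ne ei, Function.update_of_ne ej] at e
      refine hh.inj i ?_ j e
      simpa [mem_alive, Function.update_of_ne ei] using hi
  covers p hp := by
    rw [alive_update (by omega)]
    by_cases hps : p < σ.length
    · obtain ⟨i, hi, hip⟩ := hh.covers p hps
      have hne : i ≠ i₀ := fun e => mem_alive.1 hi (e ▸ hi₀)
      refine ⟨i, Finset.mem_insert_of_mem hi, ?_⟩
      have : startPos (Function.update h i₀ x) i = startPos h i := by
        simp [startPos, Function.update_of_ne hne]
      rw [this]
      exact hip.append u
    · have hpe : p = σ.length := by simp at hp; omega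
      refine ⟨i₀, Finset.mem_insert_self _ _, ?_⟩
      have : startPos (Function.update h i₀ x) i₀ = p := by simp [startPos, hx, hpe]
      rw [this]
      exact coversAt_self hf hm hp

theorem IsHist.prune {f : List U → ℝ} {m n q : ℕ} {ρ β a : ℝ} (hf : IsSmooth f m n q ρ β)
    (hβ : β ≤ 1) (ha : 0 ≤ a) (haβ : 4 * a ≤ β) {σ : List U} (hm : σ.length ≤ m)
    {h : Fin L → Word w} (hh : IsHist f β σ h) {v : Fin L → ℝ}
    (hv : Accurate f a σ (startPos h) v (alive h)) (W : ℕ) (scale : ℝ → ℝ≥0) :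
    IsHist f β σ ((histPolicy w L (1 - β / 2) W scale).prune h v) where
  hdr_le i := by
    by_cases hi : i ∈ pruned (1 - β / 2) (startPos h) v (alive h)
    · rw [prune_eq hi]; exact hh.hdr_le i
    · simp [histPolicy, hi, zeroWord]
  inj i hi j e := by
    rw [alive_prune] at hi
    have hj : j ∈ alive ((histPolicy w L (1 - β / 2) W scale).prune h v) := by
      rw [mem_alive, ← e, prune_eq hi]
      exact mem_alive.1 (pruned_subset _ _ _ _ hi)
    rw [alive_prune] at hj
    rw [prune_eq hi, prune_eq hj] at e
    exact hh.inj i (pruned_subset _ _ _ _ hi) j e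
  covers := by
    rw [alive_prune]
    intro p hp
    obtain ⟨i, hi, hip⟩ := hh.covers.pruned hf hβ ha haβ hm (fun i hi => hh.startPos_lt hi) hv p hp
    refine ⟨i, hi, ?_⟩
    have : startPos ((histPolicy w L (1 - β / 2) W scale).prune h v) i = startPos h i := by
      rw [startPos, prune_eq hi, startPos]
    rwa [this]

/-- The output approximates the value of `f` on the window. -/
def OutputGood (f : List U → ℝ) (W : ℕ) (ρ : ℝ) (scale : ℝ → ℝ≥0) (σ : List U)
    (o : Option (ℝ × ℝ≥0)) : Prop :=
  ∃ v, o = some (v, scale v) ∧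
    (1 - 2 * ρ) * f (σ.rtake W) ≤ v ∧ v ≤ (1 + 2 * ρ) * f (σ.rtake W)

theorem IsHist.outputGood {f : List U → ℝ} {m n q : ℕ} {ρ β a : ℝ} (hf : IsSmooth f m n q ρ β)
    (hρ : ρ ≤ 1 / 4) (ha : 0 ≤ a) (haβ : 4 * a ≤ β) {σ : List U} (hm : σ.length ≤ m)
    (hσ : σ ≠ []) {W : ℕ} (hW : 1 ≤ W) {h : Fin L → Word w} (hh : IsHist f β σ h) {v : Fin L → ℝ}
    (hv : Accurate f a σ (startPos h) v (alive h)) (scale : ℝ → ℝ≥0) (θ : ℝ) {x : Word w}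
    (hx : (x : ℕ) = σ.length) :
    OutputGood f W ρ scale σ (some ((histPolicy w L θ W scale).res x h v)) := by
  have hpos : 0 < σ.length := List.length_pos_of_ne_nil hσ
  have hp : (x : ℕ) - W < σ.length := by omega
  have hex : ∃ i, IsLast h (x - W) i := by
    obtain ⟨i, hi, hip⟩ := hh.covers _ hp
    exact exists_isLast ⟨i, hi, hip.1⟩
  obtain ⟨h₁, h₂, h₃⟩ := hex.choose_spec
  refine ⟨v hex.choose, ?_, ?_⟩
  · simp [histPolicy, hex]
  · have := hh.covers.approx hf hρ ha haβ hm hv hp h₁ h₂ h₃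
    have e : σ.rtake W = σ.drop (x - W) := by rw [List.rtake, hx]
    rwa [e]

end policy

end DPHist

end

noncomputable section

namespace DPHist

open Prog StreamAlg

/-! ### The failure probability of the histogram algorithm -/

section failure

variable {w L : ℕ} {U : Type}

/-- The memory of the machine after the stream `σ`, as long as no copy has returned a bad output. -/
structure MemGood (c : ℕ) (f : List U → ℝ) (β : ℝ) (N : ℕ) (σ : List U)
    (M : Mem w (numCells L c)) : Prop where
  clk_eq : (M clk : ℕ) = σ.length
  -- No stamp lies in the future, so writing the next birth time into a header invalidates all cells
  -- of that slot.
  stamp_le : ∀ i j, (M (stamp i j) : ℕ) ≤ σ.length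
  hist : IsHist f β σ fun i => M (hdr i)
  card_le : (alive fun i => M (hdr i)).card ≤ 2 * N

/-- The expected number of bad outputs of the copies that are alive, on the remaining updates. -/
def aliveBad (A : StreamAlg w U ℝ) (f : List U → ℝ) (a : ℝ) (τ σ : List U) (h : Fin L → Word w)
    (M : Mem w (numCells L A.cells)) : ℝ≥0∞ :=
  ∑ i ∈ alive h, A.futureBad f a τ (σ.drop (startPos h i)) (view M i (h i))

open Classical in
/-- The indicator of the event that the output is not good. -/
def outputBad (f : List U → ℝ) (W : ℕ) (ρ : ℝ) (scale : ℝ → ℝ≥0) (σ : List U)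
    (o : Option (ℝ × ℝ≥0)) : ℝ≥0∞ :=
  if OutputGood f W ρ scale σ o then 0 else 1

theorem outputBad_le_one (f : List U → ℝ) (W : ℕ) (ρ : ℝ) (scale : ℝ → ℝ≥0) (σ : List U)
    (o : Option (ℝ × ℝ≥0)) : outputBad f W ρ scale σ o ≤ 1 := by
  unfold outputBad
  split_ifs <;> simp

variable {f : List U → ℝ} {m n q W N : ℕ} {ρ β a : ℝ} {scale : ℝ → ℝ≥0}

/-- Either all living estimates are accurate, and then pruning restores the invariant and only drops
nonnegative terms; or some estimate is bad, and its indicator `1` alone pays for the postcondition,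
which is at most `1`. -/
theorem wp_finish_le (A : StreamAlg w U ℝ) (hf : IsSmooth f m n q ρ β) (hρ : ρ ≤ 1 / 4)
    (ha : 0 ≤ a) (haβ : 4 * a ≤ β) (hW : 1 ≤ W)
    (hN : (1 - β / 2) ^ N * (2 * (n : ℝ) ^ q) < 1 / 2)
    (Φ : (ℝ × ℝ≥0) × Mem w (numCells L A.cells) → ℝ≥0∞) (hΦ : ∀ y, Φ y ≤ 1) {σ τ : List U}
    (hσ : σ ≠ []) (hm : σ.length ≤ m) {x : Word w} (hx : (x : ℕ) = σ.length)
    {h : Fin L → Word w} (hh : IsHist f β σ h) {C : ℝ≥0∞}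
    (hstep : ∀ o M, MemGood A.cells f β N σ M → OutputGood f W ρ scale σ (some o) →
      Φ (o, M) ≤ aliveBad A f a τ σ (fun i => M (hdr i)) M + C)
    (v : Fin L → ℝ) {M : Mem w (numCells L A.cells)} (hclk : M clk = x)
    (hstamp : ∀ i j, (M (stamp i j) : ℕ) ≤ σ.length) :
    ((histPolicy w L (1 - β / 2) W scale).finish A.cells x h (List.finRange L) v).wp Φ M
      ≤ ∑ i, (if i ∈ alive h then badOut f a (σ.drop (startPos h i)) (v i)
          + A.futureBad f a τ (σ.drop (startPos h i)) (view M i (h i)) else 0) + C := by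
  set P := histPolicy w L (1 - β / 2) W scale with hP
  have hβ : β ≤ 1 := by linarith [hf.le]
  by_cases hv : Accurate f a σ (startPos h) v (alive h)
  · refine wp_writeHdrs_le _ _ _ _ _ _ fun M' h₁ h₂ => ?_
    have hhdr : (fun i => M' (hdr i)) = P.prune h v :=
      funext fun i => h₁ i (List.mem_finRange i)
    have hs : ∀ i j, M' (stamp i j) = M (stamp i j) := fun i j =>
      h₂ _ fun i' _ => by simp [stamp, hdr]
    have hva : ∀ i j, M' (val i j) = M (val i j) := fun i j =>
      h₂ _ fun i' _ => by simp [val, hdr]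
    have hview : ∀ i y, view M' i y = view M i y := fun i y => by
      funext j; simp only [view, hs, hva]
    have hgood : MemGood A.cells f β N σ M' := by
      refine ⟨?_, fun i j => ?_, ?_, ?_⟩
      · rw [h₂ clk fun i' _ => by simp [clk, hdr], hclk, hx]
      · rw [hs]; exact hstamp i j
      · rw [hhdr]; exact hh.prune hf hβ ha haβ hm hv W scale
      · rw [hhdr, alive_prune]
        exact card_pruned_le hf hβ (by linarith) hm hh.injOn (fun i hi => hh.startPos_lt hi) hv hN
    refine (hstep _ M' hgood (hh.outputGood hf hρ ha haβ hm hσ hW hv scale _ hx)).trans ?_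
    gcongr
    rw [aliveBad, hhdr, alive_prune, ← Finset.sum_filter, Finset.filter_mem_eq_inter,
      Finset.univ_inter]
    refine (Finset.sum_le_sum fun i hi => ?_).trans
      (Finset.sum_le_sum_of_subset (pruned_subset (1 - β / 2) (startPos h) v (alive h)))
    have e : startPos (P.prune h v) i = startPos h i := by rw [startPos, prune_eq hi, startPos]
    rw [e, h₁ i (List.mem_finRange i), prune_eq hi, hview]
    exact le_add_self
  · have : ∃ i ∈ alive h, badOut f a (σ.drop (startPos h i)) (v i) = 1 := by
      unfold Accurate at hv
      push Not at hv
      obtain ⟨i, hi, hi'⟩ := hv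
      refine ⟨i, hi, ?_⟩
      unfold badOut
      rw [if_neg fun hc => not_lt.2 hc.2 (hi' hc.1)]
    obtain ⟨i, hi, hbad⟩ := this
    refine (wp_mono _ hΦ _).trans ?_
    rw [wp_const]
    refine le_trans ?_ le_self_add
    refine le_trans ?_ (Finset.single_le_sum (fun _ _ => zero_le) (Finset.mem_univ i))
    rw [if_pos hi, hbad]
    exact le_self_add

/-- The right side is a potential. A birth moves one term from `birthsBad` to the living copies,
running the copies turns `futureBad` into the present indicator plus the later ones, and
`wp_finish_le` closes the update. -/
theorem future_le (A : StreamAlg w U ℝ) (hf : IsSmooth f m n q ρ β) (hρ : ρ ≤ 1 / 4)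
    (ha : 0 ≤ a) (haβ : 4 * a ≤ β) (hW : 1 ≤ W)
    (hN : (1 - β / 2) ^ N * (2 * (n : ℝ) ^ q) < 1 / 2) (hL : 2 * N < L) (hmw : m < 2 ^ w)
    {ω : List U} (hω : ω.length ≤ m) (τ σ : List U) (hτ : σ ++ τ = ω)
    (o : Option (ℝ × ℝ≥0)) (M : Mem w (numCells L A.cells)) (hM : MemGood A.cells f β N σ M)
    (ho : σ ≠ [] → OutputGood f W ρ scale σ o) (hω₀ : ω ≠ []) :
    ((histPolicy w L (1 - β / 2) W scale).alg A).future (outputBad f W ρ scale ω) τ (o, M)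
      ≤ aliveBad A f a τ σ (fun i => M (hdr i)) M + A.birthsBad f a τ := by
  induction τ generalizing σ o M with
  | nil =>
    rw [List.append_nil] at hτ
    subst hτ
    rw [future, outputBad, if_pos (ho hω₀)]
    exact zero_le
  | cons u τ ih =>
    set P := histPolicy w L (1 - β / 2) W scale with hP
    set h₀ : Fin L → Word w := fun i => M (hdr i) with hh₀
    set σ' := σ ++ [u] with hσ'
    have hτ' : σ' ++ τ = ω := by rw [← hτ, hσ']; simp
    have hlen : σ'.length = σ.length + 1 := by simp [hσ']
    have hm : σ'.length ≤ m := le_trans (by rw [← hτ']; simp) hω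
    set x : Word w := succWord (M clk) with hxdef
    -- The clock does not overflow, since the time is at most `m < 2 ^ w`.
    have hx : (x : ℕ) = σ.length + 1 := by
      rw [hxdef, succWord]
      simp only [hM.clk_eq]
      exact Nat.mod_eq_of_lt (by omega)
    set M₁ : Mem w (numCells L A.cells) := Function.update M clk x with hM₁
    have hM₁hdr : (fun i => M₁ (hdr i)) = h₀ := by
      funext i; simp [hM₁, hh₀, clk, hdr]
    have hM₁s : ∀ i j, M₁ (stamp i j) = M (stamp i j) := fun i j => by simp [hM₁, clk, stamp]
    have hM₁v : ∀ i j, M₁ (val i j) = M (val i j) := fun i j => by simp [hM₁, clk, val]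
    have hview : ∀ i y, view M₁ i y = view M i y := fun i y => by
      funext j; simp only [view, hM₁s, hM₁v]
    -- At most `2 * N < L` slots are occupied after pruning.
    have hfree : ∃ i, (h₀ i : ℕ) = 0 := by
      by_contra! hne
      have : alive h₀ = Finset.univ := by ext i; simpa [mem_alive] using hne i
      have hc := hM.card_le
      rw [this] at hc
      simp at hc
      omega
    obtain ⟨i₀, hi₀, halloc⟩ : ∃ i₀, (h₀ i₀ : ℕ) = 0 ∧ P.alloc x h₀ = Function.update h₀ i₀ x :=
      ⟨hfree.choose, hfree.choose_spec, dif_pos hfree⟩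
    set h := Function.update h₀ i₀ x with hh
    have halive : alive h = insert i₀ (alive h₀) := alive_update (by omega)
    have hi₀' : i₀ ∉ alive h₀ := by simp [mem_alive, hi₀]
    have hhist : IsHist f β σ' h := hM.hist.update hf hm hi₀ hx
    set Φ : (ℝ × ℝ≥0) × Mem w (numCells L A.cells) → ℝ≥0∞ := fun y =>
      (P.alg A).future (outputBad f W ρ scale ω) τ (some y.1, y.2) with hΦ
    set g : Fin L → ℝ × Mem w A.cells → ℝ≥0∞ := fun i y =>
      if i ∈ alive h then badOut f a (σ'.drop (startPos h i)) y.1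
          + A.futureBad f a τ (σ'.drop (startPos h i)) y.2 else 0 with hg
    have hrun : (P.alg A).future (outputBad f W ρ scale ω) (u :: τ) (o, M)
        = (P.simulate (A.step u) x h (List.finRange L) 0).wp Φ M₁ := by
      have e : (P.alg A).future (outputBad f W ρ scale ω) (u :: τ) (o, M)
          = (P.load (A.step u) x (List.finRange L) fun _ => zeroWord w).wp Φ M₁ := rfl
      rw [e, Policy.load, wp_readHdrs _ _ _ _ _ (fun i hi => absurd (List.mem_finRange i) hi),
        hM₁hdr, halloc]
    have hsim := wp_runSlots_le (A.step u) h (P.finish A.cells x h (List.finRange L)) Φ g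
      (A.birthsBad f a τ) M₁ (fun v M' hM' => by
        refine wp_finish_le A hf hρ ha haβ hW hN Φ
          (fun y => future_le_one _ (outputBad_le_one _ _ _ _ _) _ _) (by simp [hσ']) hm
          (hx.trans hlen.symm) hhist
          (fun o M hM ho => ih σ' hτ' (some o) M hM fun _ => ho) v ?_ ?_
        · rw [hM'.clk_eq, hM₁]; simp
        · intro i j
          rcases hM'.stamp_or i j with e | e
          · rw [e, hM₁s]
            have := hM.stamp_le i j
            omega
          · rw [e]; exact hhist.hdr_le i) (List.finRange L) (List.nodup_finRange L) 0 M₁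
      ⟨rfl, fun _ _ => Or.inl rfl⟩
    rw [hrun]
    refine hsim.trans ?_
    simp only [List.mem_finRange, if_true]
    have hterm : ∀ i, (A.step u).wp (g i) (view M₁ i (h i))
        = if i ∈ alive h then A.futureBad f a (u :: τ) (σ.drop (startPos h i)) (view M i (h i))
          else 0 := by
      intro i
      by_cases hi : i ∈ alive h
      · have hle : startPos h i ≤ σ.length := by
          have := hhist.startPos_lt hi
          omega
        have e : σ'.drop (startPos h i) = σ.drop (startPos h i) ++ [u] :=
          List.drop_append_of_le_length hle
        simp only [hg, hi, if_true, e, hview, futureBad]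
      · simp only [hg, hi, if_false]
        exact wp_const _ _ _
    rw [Finset.sum_congr rfl fun i _ => hterm i, ← Finset.sum_filter, Finset.filter_mem_eq_inter,
      Finset.univ_inter, halive, Finset.sum_insert hi₀', birthsBad]
    have hnew : A.futureBad f a (u :: τ) (σ.drop (startPos h i₀)) (view M i₀ (h i₀))
        = A.futureBad f a (u :: τ) [] (zeroMem w A.cells) := by
      have e₁ : startPos h i₀ = σ.length := by simp [startPos, hh, hx]
      have e₂ : view M i₀ (h i₀) = zeroMem w A.cells := by
        funext j
        have hne : M (stamp i₀ j) ≠ x := fun e => by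
          have := hM.stamp_le i₀ j
          rw [e] at this
          omega
        simp [view, hh, hne, zeroMem, zeroWord]
      rw [e₁, e₂, List.drop_length]
    have hold : ∑ i ∈ alive h₀, A.futureBad f a (u :: τ) (σ.drop (startPos h i)) (view M i (h i))
        = aliveBad A f a (u :: τ) σ h₀ M := by
      refine Finset.sum_congr rfl fun i hi => ?_
      have hne : i ≠ i₀ := fun e => hi₀' (e ▸ hi)
      have e : h i = h₀ i := by rw [hh, Function.update_of_ne hne]
      rw [startPos, e, startPos]
    rw [hnew, hold]
    exact le_of_eq (by ring)

/-- The probability that the output of the histogram algorithm is not good. -/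
theorem outputLaw_bad_le (A : StreamAlg w U ℝ) {d : ℝ} (hA : A.IsApprox f m a d) (hd : 0 ≤ d)
    (hd' : d ≤ 1) (hf : IsSmooth f m n q ρ β) (hρ : ρ ≤ 1 / 4)
    (ha : 0 ≤ a) (haβ : 4 * a ≤ β) (hW : 1 ≤ W)
    (hN : (1 - β / 2) ^ N * (2 * (n : ℝ) ^ q) < 1 / 2) (hL : 2 * N < L) (hmw : m < 2 ^ w)
    {σ : List U} (hσ : σ.length = m) (hσ₀ : σ ≠ []) :
    (((histPolicy w L (1 - β / 2) W scale).alg A).outputLaw σ).toOuterMeasure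
      {o | ¬ OutputGood f W ρ scale σ o} ≤ ENNReal.ofReal ((m : ℝ) ^ 2 * d) := by
  set P := histPolicy w L (1 - β / 2) W scale with hP
  have h₁ : ((P.alg A).outputLaw σ).toOuterMeasure {o | ¬ OutputGood f W ρ scale σ o}
      = (P.alg A).future (outputBad f W ρ scale σ) σ (none, zeroMem w (P.alg A).cells) := by
    rw [← expect_outputLaw, ← expect_indicator]
    congr 1
    funext o
    by_cases ho : OutputGood f W ρ scale σ o <;> simp [outputBad, ho]
  have h₂ : alive (fun i : Fin L => zeroMem w (numCells L A.cells) (hdr i)) = ∅ := by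
    ext i; simp [mem_alive, zeroMem]
  have h₃ : MemGood A.cells f β N ([] : List U) (zeroMem w (numCells L A.cells)) := by
    refine ⟨rfl, fun _ _ => le_rfl, ⟨fun _ => le_rfl, fun i hi => ?_, fun p hp => ?_⟩, ?_⟩
    · simp [h₂] at hi
    · simp at hp
    · simp [h₂]
  have h₄ := future_le (scale := scale) A hf hρ ha haβ hW hN hL hmw hσ.le σ [] (by simp) none
    (zeroMem w (numCells L A.cells)) h₃ (fun h => absurd rfl h) hσ₀
  rw [h₁]
  refine h₄.trans ?_
  rw [aliveBad, h₂, Finset.sum_empty, zero_add]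
  refine (A.birthsBad_le hA hd hd' σ hσ.le).trans (le_of_eq ?_)
  rw [hσ, ENNReal.ofReal_mul (by positivity), ENNReal.ofReal_pow (by positivity),
    ENNReal.ofReal_natCast, sq]

end failure

end DPHist

end

noncomputable section

namespace DPHist

open MeasureTheory

/-! ### The Laplace distribution -/

section laplace

theorem laplace_eq (μ : ℝ) {b : ℝ≥0} (hb : 0 < b) : laplace μ b = volume.withDensity
    fun x => ENNReal.ofReal (1 / (2 * b) * Real.exp (-|x - μ| / b)) := by
  rw [laplace, if_neg hb.ne']

theorem laplace_Ioi (μ : ℝ) {b : ℝ≥0} (hb : 0 < b) {t : ℝ} (ht : 0 ≤ t) :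
    laplace μ b (Set.Ioi (μ + t)) = ENNReal.ofReal (Real.exp (-t / b) / 2) := by
  have hb' : (0 : ℝ) < b := hb
  have hneg : -(1 / (b : ℝ)) < 0 := by simp [hb]
  rw [laplace_eq μ hb, withDensity_apply _ measurableSet_Ioi]
  have e : ∀ x ∈ Set.Ioi (μ + t), ENNReal.ofReal (1 / (2 * b) * Real.exp (-|x - μ| / b))
      = ENNReal.ofReal (1 / (2 * b) * Real.exp (μ / b) * Real.exp (-(1 / (b : ℝ)) * x)) := by
    intro x hx
    have : |x - μ| = x - μ := abs_of_nonneg (by linarith [Set.mem_Ioi.1 hx])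
    rw [this, mul_assoc, ← Real.exp_add]
    congr 3
    field_simp
    ring
  rw [setLIntegral_congr_fun measurableSet_Ioi e, ← ofReal_integral_eq_lintegral_ofReal
    ((integrableOn_exp_mul_Ioi hneg _).const_mul _) (Filter.Eventually.of_forall fun x => by
      simp only [Pi.zero_apply]; positivity), integral_const_mul, integral_exp_mul_Ioi hneg]
  congr 1
  rw [show -t / (b : ℝ) = μ / b + -(1 / (b : ℝ)) * (μ + t) by field_simp; ring, Real.exp_add]
  field_simp

theorem laplace_Iic (μ : ℝ) {b : ℝ≥0} (hb : 0 < b) {t : ℝ} (ht : 0 ≤ t) :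
    laplace μ b (Set.Iic (μ - t)) = ENNReal.ofReal (Real.exp (-t / b) / 2) := by
  have hb' : (0 : ℝ) < b := hb
  have hpos : 0 < 1 / (b : ℝ) := by positivity
  rw [laplace_eq μ hb, withDensity_apply _ measurableSet_Iic]
  have e : ∀ x ∈ Set.Iic (μ - t), ENNReal.ofReal (1 / (2 * b) * Real.exp (-|x - μ| / b))
      = ENNReal.ofReal (1 / (2 * b) * Real.exp (-μ / b) * Real.exp (1 / (b : ℝ) * x)) := by
    intro x hx
    have : |x - μ| = μ - x := by
      rw [abs_sub_comm]; exact abs_of_nonneg (by linarith [Set.mem_Iic.1 hx])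
    rw [this, mul_assoc, ← Real.exp_add]
    congr 3
    field_simp
    ring
  rw [setLIntegral_congr_fun measurableSet_Iic e, ← ofReal_integral_eq_lintegral_ofReal
    ((integrableOn_exp_mul_Iic hpos _).const_mul _) (Filter.Eventually.of_forall fun x => by
      simp only [Pi.zero_apply]; positivity), integral_const_mul, integral_exp_mul_Iic hpos]
  congr 1
  rw [show -t / (b : ℝ) = -μ / b + 1 / (b : ℝ) * (μ - t) by field_simp; ring, Real.exp_add]
  field_simp

theorem laplace_univ (μ : ℝ) (b : ℝ≥0) : laplace μ b Set.univ = 1 := by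
  rcases eq_or_lt_of_le (zero_le : 0 ≤ b) with hb | hb
  · rw [laplace, if_pos hb.symm]; simp
  · rw [← Set.Iic_union_Ioi (a := μ), measure_union (Set.Iic_disjoint_Ioi le_rfl) measurableSet_Ioi]
    have h₁ := laplace_Iic μ hb le_rfl
    have h₂ := laplace_Ioi μ hb le_rfl
    rw [sub_zero] at h₁
    rw [add_zero] at h₂
    rw [h₁, h₂, ← ENNReal.ofReal_add (by positivity) (by positivity), add_halves, neg_zero, zero_div,
      Real.exp_zero, ENNReal.ofReal_one]

theorem laplace_le_one (μ : ℝ) (b : ℝ≥0) (E : Set ℝ) : laplace μ b E ≤ 1 :=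
  (measure_mono (Set.subset_univ E)).trans (laplace_univ μ b).le

theorem laplace_tail_le (μ : ℝ) {b : ℝ≥0} (hb : 0 < b) {t : ℝ} (ht : 0 ≤ t) :
    laplace μ b {y | t * b < |y - μ|} ≤ ENNReal.ofReal (Real.exp (-t)) := by
  have hb' : (0 : ℝ) < b := hb
  have hsub : {y | t * b < |y - μ|} ⊆ Set.Iic (μ - t * b) ∪ Set.Ioi (μ + t * b) := by
    intro y (hy : t * b < |y - μ|)
    rcases lt_abs.1 hy with h | h
    · exact Or.inr (by simp only [Set.mem_Ioi]; linarith)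
    · exact Or.inl (by simp only [Set.mem_Iic]; linarith)
  refine (measure_mono hsub).trans ((measure_union_le _ _).trans ?_)
  rw [laplace_Iic μ hb (by positivity), laplace_Ioi μ hb (by positivity),
    ← ENNReal.ofReal_add (by positivity) (by positivity)]
  apply le_of_eq
  congr 1
  rw [show -(t * (b : ℝ)) / b = -t by field_simp]
  ring

/-- Laplace distributions whose means and scales are close are indistinguishable. -/
theorem laplace_le {x x' : ℝ} {b b' : ℝ≥0} (hb : 0 < b) (hb' : 0 < b') {t r s : ℝ} (ht : 0 ≤ t)
    (hx : |x - x'| ≤ s * b') (h₁ : (b' : ℝ) - b ≤ r * b) (h₂ : (b : ℝ) - b' ≤ r * b')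
    {E : Set ℝ} (hE : MeasurableSet E) :
    laplace x b E ≤ ENNReal.ofReal (Real.exp (s + r + r * t)) * laplace x' b' E
      + ENNReal.ofReal (Real.exp (-t)) := by
  have hbp : (0 : ℝ) < b := hb
  have hbp' : (0 : ℝ) < b' := hb'
  -- With different scales the ratio of the densities may be unbounded, so the comparison is made
  -- within `t` scales of the mean; the rest has mass at most `exp (-t)`.
  set R : Set ℝ := {y | |y - x| ≤ t * b} with hR
  have hRm : MeasurableSet R := by
    apply measurableSet_le <;> fun_prop
  have hsplit : laplace x b E ≤ laplace x b (E ∩ R) + laplace x b {y | t * b < |y - x|} := by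
    refine (measure_mono fun y hy => ?_).trans (measure_union_le _ _)
    by_cases h : |y - x| ≤ t * b
    · exact Or.inl ⟨hy, h⟩
    · exact Or.inr (not_le.1 h)
  have hin : laplace x b (E ∩ R)
      ≤ ENNReal.ofReal (Real.exp (s + r + r * t)) * laplace x' b' E := by
    refine le_trans ?_ (mul_le_mul_right (measure_mono (Set.inter_subset_left (t := R))) _)
    rw [laplace_eq x hb, laplace_eq x' hb', withDensity_apply _ (hE.inter hRm),
      withDensity_apply _ (hE.inter hRm), ← lintegral_const_mul' _ _ ENNReal.ofReal_ne_top]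
    refine setLIntegral_mono' (hE.inter hRm) fun y hy => ?_
    have hy' : |y - x| ≤ t * b := hy.2
    rw [← ENNReal.ofReal_mul (Real.exp_pos _).le]
    apply ENNReal.ofReal_le_ofReal
    -- The normalizing constants cost `r`. In the exponent, the shift of the mean costs `s` and the
    -- change of scale at most `r * t`.
    have k₁ : 1 / (2 * (b : ℝ)) ≤ Real.exp r * (1 / (2 * b')) := by
      have : (b' : ℝ) ≤ Real.exp r * b := by nlinarith [Real.add_one_le_exp r]
      rw [mul_one_div, div_le_div_iff₀ (by positivity) (by positivity)]
      linarith
    have k₂ : -|y - x| / (b : ℝ) ≤ s + r * t + -|y - x'| / b' := by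
      have e₁ : |y - x'| ≤ |y - x| + |x - x'| := abs_sub_le _ _ _
      have e₂ : |y - x'| / b' ≤ |y - x| / b' + s := by
        rw [div_le_iff₀ hbp', add_mul, div_mul_cancel₀ _ hbp'.ne']
        linarith
      have e₃ : |y - x| / (b' : ℝ) ≤ |y - x| / b + r * t := by
        set z := |y - x| / (b : ℝ) with hz
        have hzb : |y - x| = z * b := by rw [hz]; field_simp
        have hzt : z ≤ t := by rw [hz, div_le_iff₀ hbp]; exact hy'
        have hz0 : 0 ≤ z := by positivity
        rw [div_le_iff₀ hbp', hzb]
        rcases le_total (0 : ℝ) r with hr | hr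
        · nlinarith [mul_le_mul_of_nonneg_left h₂ hz0,
            mul_le_mul_of_nonneg_right hzt (mul_nonneg hr hbp'.le)]
        -- Adding `h₁` and `h₂` gives `0 ≤ r * (b + b')`, so this case contains only `r = 0`.
        · nlinarith
      rw [neg_div, neg_div]
      linarith
    calc 1 / (2 * (b : ℝ)) * Real.exp (-|y - x| / b)
        ≤ (Real.exp r * (1 / (2 * b'))) * Real.exp (s + r * t + -|y - x'| / b') := by
          gcongr
      _ = Real.exp (s + r + r * t) * (1 / (2 * b') * Real.exp (-|y - x'| / b')) := by
          rw [Real.exp_add, show s + r + r * t = r + (s + r * t) by ring, Real.exp_add r]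
          ring
  exact hsplit.trans (add_le_add hin (laplace_tail_le x hb ht))

end laplace

/-! ### Mixtures -/

section mixture

variable {α : Type}

/-- The pointwise bound holds for every pair of good outputs, so averaging over each law separately
suffices and no coupling is needed. -/
theorem expect_le_of_good (μ ν : PMF α) {φ ψ : α → ℝ≥0∞} {G H : Set α} {K δ D : ℝ≥0∞}
    (hφ : ∀ a, φ a ≤ 1) (h : ∀ a ∈ G, ∀ a' ∈ H, φ a ≤ K * ψ a' + δ)
    (hμ : μ.toOuterMeasure Gᶜ ≤ D) (hν : ν.toOuterMeasure Hᶜ ≤ D) :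
    expect μ φ ≤ K * expect ν ψ + δ + D + D := by
  have h₁ : ∀ a ∈ G, φ a ≤ K * expect ν ψ + δ + D := by
    intro a ha
    have e : φ a ≤ expect ν (fun a' => (K * ψ a' + δ) + Hᶜ.indicator (fun _ => 1) a') := by
      rw [← expect_const ν (φ a)]
      refine expect_mono _ fun a' => ?_
      by_cases ha' : a' ∈ H
      · exact (h a ha a' ha').trans le_self_add
      · rw [Set.indicator_of_mem (by simpa using ha')]
        exact (hφ a).trans le_add_self
    rw [expect_add, expect_add, expect_const, expect_indicator] at e
    have e' : expect ν (fun a' => K * ψ a') = K * expect ν ψ := by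
      unfold expect
      rw [← ENNReal.tsum_mul_left]
      exact tsum_congr fun a => by ring
    rw [e'] at e
    exact e.trans (by gcongr)
  calc expect μ φ ≤ expect μ (fun a => (K * expect ν ψ + δ + D) + Gᶜ.indicator (fun _ => 1) a) := by
        refine expect_mono _ fun a => ?_
        by_cases ha : a ∈ G
        · exact (h₁ a ha).trans le_self_add
        · rw [Set.indicator_of_mem (by simpa using ha)]
          exact (hφ a).trans le_add_self
    _ ≤ _ := by
        rw [expect_add, expect_const, expect_indicator]
        gcongr

theorem le_expect_of_good (μ : PMF α) {φ : α → ℝ≥0∞} {G : Set α} {K D : ℝ≥0∞} (hK : K ≤ 1)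
    (h : ∀ a ∈ G, K ≤ φ a) (hμ : μ.toOuterMeasure Gᶜ ≤ D) : K ≤ expect μ φ + D := by
  calc K = expect μ fun _ => K := (expect_const μ K).symm
    _ ≤ expect μ (fun a => φ a + Gᶜ.indicator (fun _ => 1) a) := by
        refine expect_mono _ fun a => ?_
        by_cases ha : a ∈ G
        · exact (h a ha).trans le_self_add
        · rw [Set.indicator_of_mem (by simpa using ha)]
          exact hK.trans le_add_self
    _ ≤ _ := by
        rw [expect_add, expect_indicator]
        gcongr

/-- The probability of `E` for a given output of the algorithm. -/
def releaseProb (E : Set ℝ) : Option (ℝ × ℝ≥0) → ℝ≥0∞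
  | none => 0
  | some o => laplace o.1 o.2 E

theorem releaseProb_le_one (E : Set ℝ) (o : Option (ℝ × ℝ≥0)) : releaseProb E o ≤ 1 := by
  cases o with
  | none => simp [releaseProb]
  | some o => exact laplace_le_one _ _ _

theorem releaseLaw_apply {w : ℕ} {U : Type} (A : StreamAlg w U (ℝ × ℝ≥0)) (σ : List U) {E : Set ℝ}
    (hE : MeasurableSet E) : A.releaseLaw σ E = expect (A.outputLaw σ) (releaseProb E) := by
  rw [StreamAlg.releaseLaw, Measure.sum_apply _ hE, expect,
    ← (Option.some_injective (ℝ × ℝ≥0)).tsum_eq fun o ho => ?_]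
  · rfl
  · cases o with
    | none => simp [releaseProb] at ho
    | some o => exact ⟨o, rfl⟩

end mixture

end DPHist

end

noncomputable section

namespace DPHist

open MeasureTheory

/-! ### Sensitivity -/

section sensitivity

variable {U : Type}

theorem globalSensitivity_nonneg (f : List U → ℝ) (ℓ : ℕ) : 0 ≤ globalSensitivity f ℓ := by
  refine Real.sSup_nonneg ?_
  rintro d ⟨σ, τ, -, -, -, rfl⟩
  exact abs_nonneg _

/-- Finiteness of the universe makes the set of differences bounded, without which the real supremum
would carry no information. -/
theorem abs_sub_le_globalSensitivity [Finite U] (f : List U → ℝ) {ℓ : ℕ} {σ τ : List U}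
    (hσ : σ.length = ℓ) (hτ : τ.length = ℓ) (h : Neighboring σ τ) :
    |f σ - f τ| ≤ globalSensitivity f ℓ := by
  refine le_csSup (Set.Finite.bddAbove ?_) ⟨σ, τ, hσ, hτ, h, rfl⟩
  have hfin : {l : List U | l.length = ℓ}.Finite := List.finite_length_eq U ℓ
  refine ((hfin.prod hfin).image fun x => |f x.1 - f x.2|).subset ?_
  rintro d ⟨σ, τ, h₁, h₂, -, rfl⟩
  exact ⟨(σ, τ), ⟨h₁, h₂⟩, rfl⟩

theorem Neighboring.rtake {σ τ : List U} (h : Neighboring σ τ) (W : ℕ) :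
    σ.rtake W = τ.rtake W ∨ Neighboring (σ.rtake W) (τ.rtake W) := by
  obtain ⟨l, r, a, b, rfl, rfl⟩ := h
  have hlen : (l ++ a :: r).length = (l ++ b :: r).length := by simp
  unfold List.rtake
  rw [← hlen]
  generalize (l ++ a :: r).length - W = k
  rcases le_or_gt k l.length with hk | hk
  · right
    rw [List.drop_append_of_le_length hk, List.drop_append_of_le_length hk]
    exact ⟨l.drop k, r, a, b, rfl, rfl⟩
  · left
    obtain ⟨d, rfl⟩ := Nat.exists_eq_add_of_lt hk
    rw [add_assoc, ← List.drop_drop, ← List.drop_drop]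
    simp

theorem length_rtake (σ : List U) (W : ℕ) : (σ.rtake W).length = min σ.length W := by
  rw [List.rtake, List.length_drop]
  omega

theorem abs_sub_window_le [Finite U] (f : List U → ℝ) {m : ℕ} (W : ℕ) {σ τ : List U}
    (hσ : σ.length = m) (hτ : τ.length = m) (h : Neighboring σ τ) :
    |f (σ.rtake W) - f (τ.rtake W)| ≤ globalSensitivity f (min m W) := by
  rcases h.rtake W with e | e
  · rw [e, sub_self, abs_zero]
    exact globalSensitivity_nonneg _ _
  · exact abs_sub_le_globalSensitivity f (by rw [length_rtake, hσ]) (by rw [length_rtake, hτ]) e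

theorem IsSmooth.one_le_window {f : List U → ℝ} {m n q : ℕ} {ρ β : ℝ} (hf : IsSmooth f m n q ρ β)
    {W : ℕ} (hW : 1 ≤ W) {σ : List U} (hσ : σ.length = m) (hm : 1 ≤ m) : 1 ≤ f (σ.rtake W) :=
  hf.one_le_drop hσ.le (by omega)

end sensitivity

/-! ### Privacy and accuracy of the release -/

section release

/-- The scale of the noise that is added to the value `v`. -/
def noiseScale (Δ ρ ε v : ℝ) : ℝ≥0 := Real.toNNReal (3 / 2 * (Δ + 8 * ρ * v) / ε)

variable {Δ ρ ε g v : ℝ}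

theorem coe_noiseScale (hΔ : 0 ≤ Δ) (hρ : 0 < ρ) (hε : 0 < ε) (hv : 0 < v) :
    (noiseScale Δ ρ ε v : ℝ) = 3 / 2 * (Δ + 8 * ρ * v) / ε :=
  Real.coe_toNNReal _ (by positivity)

theorem noiseScale_pos (hΔ : 0 ≤ Δ) (hρ : 0 < ρ) (hε : 0 < ε) (hv : 0 < v) :
    0 < noiseScale Δ ρ ε v :=
  Real.toNNReal_pos.2 (by positivity)

theorem approx_pos (hρ : ρ ≤ 1 / 40) (hg : 1 ≤ g) (hv : (1 - 2 * ρ) * g ≤ v) : 0 < v := by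
  nlinarith

/-- The difference `X` is at most `Δ + 4 * ρ * (v + v')`. Replacing `v` by `v' + X` costs `X / 10`,
so `X` is at most `10 / 9 ≤ 9 / 8` times `Δ + 8 * ρ * v'`; the factor `3 / 2` in the scale turns `9
/ 8` into the privacy cost `3 / 4 * ε`. -/
theorem abs_sub_le_noiseScale {g' v' : ℝ} (hΔ : 0 ≤ Δ) (hρ : 0 < ρ) (hρ' : ρ ≤ 1 / 40)
    (hε : 0 < ε) (hg : 1 ≤ g) (hg' : 1 ≤ g') (hgg : |g - g'| ≤ Δ)
    (hv : (1 - 2 * ρ) * g ≤ v ∧ v ≤ (1 + 2 * ρ) * g)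
    (hv' : (1 - 2 * ρ) * g' ≤ v' ∧ v' ≤ (1 + 2 * ρ) * g') :
    |v - v'| ≤ 3 / 4 * ε * noiseScale Δ ρ ε v' := by
  have hvp := approx_pos hρ' hg hv.1
  have hvp' := approx_pos hρ' hg' hv'.1
  rw [coe_noiseScale hΔ hρ hε hvp']
  have e : 3 / 4 * ε * (3 / 2 * (Δ + 8 * ρ * v') / ε) = 9 / 8 * (Δ + 8 * ρ * v') := by
    field_simp; ring
  rw [e]
  set X := |v - v'| with hX
  have h₁ : 2 * ρ * g ≤ 4 * ρ * v := by
    have : g ≤ 2 * v := by nlinarith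
    nlinarith
  have h₂ : 2 * ρ * g' ≤ 4 * ρ * v' := by
    have : g' ≤ 2 * v' := by nlinarith
    nlinarith
  have h₃ : X ≤ Δ + 4 * ρ * v + 4 * ρ * v' := by
    obtain ⟨a₁, a₂⟩ := abs_le.1 hgg
    rw [hX, abs_le]
    constructor <;> linarith [hv.1, hv.2, hv'.1, hv'.2]
  have h₄ : v ≤ v' + X := by linarith [le_abs_self (v - v')]
  have h₅ : 0 ≤ X := abs_nonneg _
  have h₆ : ρ * v ≤ ρ * v' + X / 40 := by nlinarith
  linarith [mul_nonneg hρ.le hvp'.le]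

/-- The scale is affine in the estimate with slope `12 * ρ / ε`, and the estimates differ by at most
`3 / 4 * ε` scales. -/
theorem noiseScale_sub_le {g' v' : ℝ} (hΔ : 0 ≤ Δ) (hρ : 0 < ρ) (hρ' : ρ ≤ 1 / 40)
    (hε : 0 < ε) (hg : 1 ≤ g) (hg' : 1 ≤ g') (hgg : |g - g'| ≤ Δ)
    (hv : (1 - 2 * ρ) * g ≤ v ∧ v ≤ (1 + 2 * ρ) * g)
    (hv' : (1 - 2 * ρ) * g' ≤ v' ∧ v' ≤ (1 + 2 * ρ) * g') :
    (noiseScale Δ ρ ε v : ℝ) - noiseScale Δ ρ ε v' ≤ 9 * ρ * noiseScale Δ ρ ε v' := by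
  have h := abs_sub_le_noiseScale hΔ hρ hρ' hε hg hg' hgg hv hv'
  have hvp := approx_pos hρ' hg hv.1
  have e : (noiseScale Δ ρ ε v : ℝ) - noiseScale Δ ρ ε v' = 12 * ρ / ε * (v - v') := by
    rw [coe_noiseScale hΔ hρ hε hvp, coe_noiseScale hΔ hρ hε (approx_pos hρ' hg' hv'.1)]
    field_simp; ring
  rw [e]
  calc 12 * ρ / ε * (v - v') ≤ 12 * ρ / ε * (3 / 4 * ε * noiseScale Δ ρ ε v') :=
        mul_le_mul_of_nonneg_left ((le_abs_self _).trans h) (by positivity)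
    _ = 9 * ρ * noiseScale Δ ρ ε v' := by field_simp; ring

variable {w m n q W : ℕ} {U : Type} {f : List U → ℝ} {β t D δ : ℝ}

theorem isDP_of_outputGood [Finite U] (A : StreamAlg w U (ℝ × ℝ≥0)) (hf : IsSmooth f m n q ρ β)
    (hm : 1 ≤ m) (hW : 1 ≤ W) (hρ : 0 < ρ) (hρ' : ρ ≤ 1 / 40) (hε : 0 < ε) (ht : 0 ≤ t)
    (hρt : 9 * ρ * (1 + t) ≤ ε / 4) (hD₀ : 0 ≤ D) (hδ : Real.exp (-t) + 2 * D ≤ δ)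
    (hD : ∀ σ : List U, σ.length = m → (A.outputLaw σ).toOuterMeasure
      {o | ¬ OutputGood f W ρ (noiseScale (globalSensitivity f (min m W)) ρ ε) σ o}
        ≤ ENNReal.ofReal D) :
    IsDP A.releaseLaw m ε δ := by
  intro σ τ hσ hτ hn E hE
  set Δ := globalSensitivity f (min m W) with hΔdef
  have hΔ : 0 ≤ Δ := globalSensitivity_nonneg _ _
  have hgg := abs_sub_window_le f W hσ hτ hn
  have hg := hf.one_le_window hW hσ hm
  have hg' := hf.one_le_window hW hτ hm
  rw [releaseLaw_apply A σ hE, releaseLaw_apply A τ hE]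
  refine (expect_le_of_good (A.outputLaw σ) (A.outputLaw τ) (releaseProb_le_one E)
    (G := {o | OutputGood f W ρ (noiseScale Δ ρ ε) σ o})
    (H := {o | OutputGood f W ρ (noiseScale Δ ρ ε) τ o}) (K := ENNReal.ofReal (Real.exp ε))
    (δ := ENNReal.ofReal (Real.exp (-t))) (D := ENNReal.ofReal D) (ψ := releaseProb E) ?_
    (hD σ hσ) (hD τ hτ)).trans ?_
  · rintro _ ⟨v, rfl, hv⟩ _ ⟨v', rfl, hv'⟩
    have hvp := approx_pos hρ' hg hv.1
    have hvp' := approx_pos hρ' hg' hv'.1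
    have h := laplace_le (noiseScale_pos hΔ hρ hε hvp) (noiseScale_pos hΔ hρ hε hvp') ht
      (abs_sub_le_noiseScale hΔ hρ hρ' hε hg hg' hgg hv hv')
      (noiseScale_sub_le hΔ hρ hρ' hε hg' hg (by rwa [abs_sub_comm]) hv' hv)
      (noiseScale_sub_le hΔ hρ hρ' hε hg hg' hgg hv hv') hE
    refine h.trans ?_
    simp only [releaseProb]
    gcongr
    -- The exponent is `3 / 4 * ε + 9 * ρ * (1 + t) ≤ ε`.
    linarith
  · rw [add_assoc, add_assoc]
    gcongr
    rw [← ENNReal.ofReal_add hD₀ hD₀, ← ENNReal.ofReal_add (Real.exp_pos _).le (by linarith)]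
    exact ENNReal.ofReal_le_ofReal (by linarith)

/-- Up to probability `exp (-t)` the noise is at most `t` scales: its part from `Δ` is the additive
error, its part from `ρ * v` is at most `α * g / 2`, and the estimation error `2 * ρ * g` takes the
other half. -/
theorem le_releaseLaw_of_outputGood (A : StreamAlg w U (ℝ × ℝ≥0)) (hf : IsSmooth f m n q ρ β)
    (hm : 1 ≤ m) (hW : 1 ≤ W) (hΔ : 0 ≤ Δ) (hρ : 0 < ρ) (hρ' : ρ ≤ 1 / 40) (hε : 0 < ε)
    (ht : 0 ≤ t) (hD₀ : 0 ≤ D) (hδ : Real.exp (-t) + D ≤ δ) {α : ℝ} (hρα : 4 * ρ ≤ α)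
    (htα : 48 * ρ * t / ε ≤ α) {σ : List U} (hσ : σ.length = m)
    (hD : (A.outputLaw σ).toOuterMeasure
      {o | ¬ OutputGood f W ρ (noiseScale Δ ρ ε) σ o} ≤ ENNReal.ofReal D) :
    ENNReal.ofReal (1 - δ) ≤ A.releaseLaw σ
      {y | (1 - α) * f (σ.rtake W) - 3 / 2 * Δ * t / ε ≤ y ∧
        y ≤ (1 + α) * f (σ.rtake W) + 3 / 2 * Δ * t / ε} := by
  have hg := hf.one_le_window hW hσ hm
  set g := f (σ.rtake W)
  set I : Set ℝ := {y | (1 - α) * g - 3 / 2 * Δ * t / ε ≤ y ∧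
    y ≤ (1 + α) * g + 3 / 2 * Δ * t / ε} with hI
  have hImeas : MeasurableSet I := measurableSet_Icc
  rw [releaseLaw_apply A σ hImeas]
  have hexp : Real.exp (-t) ≤ 1 := Real.exp_le_one_iff.2 (by linarith)
  have key := le_expect_of_good (A.outputLaw σ) (φ := releaseProb I)
    (G := {o | OutputGood f W ρ (noiseScale Δ ρ ε) σ o}) (K := ENNReal.ofReal (1 - Real.exp (-t)))
    (D := ENNReal.ofReal D) (by
      rw [← ENNReal.ofReal_one]
      exact ENNReal.ofReal_le_ofReal (by linarith [Real.exp_pos (-t)])) ?_ hD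
  · have h₁ : ENNReal.ofReal (1 - δ) + ENNReal.ofReal D
        ≤ expect (A.outputLaw σ) (releaseProb I) + ENNReal.ofReal D := by
      by_cases h : 0 ≤ 1 - δ
      · refine le_trans ?_ key
        rw [← ENNReal.ofReal_add h hD₀]
        exact ENNReal.ofReal_le_ofReal (by linarith)
      · rw [ENNReal.ofReal_of_nonpos (by linarith), zero_add]
        exact le_add_self
    exact (ENNReal.add_le_add_iff_right ENNReal.ofReal_ne_top).1 h₁
  · rintro _ ⟨v, rfl, hv⟩
    have hvp := approx_pos hρ' hg hv.1
    have hb := noiseScale_pos hΔ hρ hε hvp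
    have hsub : Iᶜ ⊆ {y | t * noiseScale Δ ρ ε v < |y - v|} := by
      intro y hy
      by_contra hlt
      refine hy ?_
      have hlt' : |y - v| ≤ t * noiseScale Δ ρ ε v := not_lt.1 hlt
      have e : t * (noiseScale Δ ρ ε v : ℝ)
          = 3 / 2 * Δ * t / ε + 48 * ρ * t / ε * (v / 4) := by
        rw [coe_noiseScale hΔ hρ hε hvp]
        field_simp; ring
      have h₂ : 48 * ρ * t / ε * (v / 4) ≤ α * g / 2 := by
        have hv2 : v ≤ 2 * g := by nlinarith [hv.2]
        have : 48 * ρ * t / ε * (v / 4) ≤ α * (v / 4) := by gcongr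
        nlinarith
      have h₃ : 2 * ρ * g ≤ α * g / 2 := by nlinarith
      obtain ⟨a₁, a₂⟩ := abs_le.1 hlt'
      constructor <;> linarith [hv.1, hv.2]
    have h₁ : laplace v (noiseScale Δ ρ ε v) Iᶜ ≤ ENNReal.ofReal (Real.exp (-t)) :=
      (measure_mono hsub).trans (laplace_tail_le v hb ht)
    have h₂ : laplace v (noiseScale Δ ρ ε v) I + laplace v (noiseScale Δ ρ ε v) Iᶜ = 1 := by
      rw [measure_add_measure_compl hImeas, laplace_univ]
    have h₃ : ENNReal.ofReal (1 - Real.exp (-t)) + ENNReal.ofReal (Real.exp (-t)) = 1 := by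
      rw [← ENNReal.ofReal_add (by linarith) (Real.exp_pos _).le]; simp
    refine (ENNReal.add_le_add_iff_right (ENNReal.ofReal_ne_top (r := Real.exp (-t)))).1 ?_
    rw [h₃, ← h₂]
    simp only [releaseProb]
    gcongr

end release

end DPHist

end

noncomputable section

namespace DPHist

/-! ### Choice of the parameters -/

section parameters

theorem half_le_log {m : ℕ} (hm : 2 ≤ m) : 1 / 2 ≤ Real.log m := by
  have h₁ : Real.log 2 ≤ Real.log m := Real.log_le_log (by norm_num) (by exact_mod_cast hm)
  linarith [Real.log_two_gt_d9]

/-- Half of the number of slots. -/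
def halfSlots (q b m : ℕ) (β : ℝ) : ℕ := ⌊2 / β * ((2 + q * b) * Real.log m)⌋₊ + 1

/-- The number of slots makes the power smaller than `m ^ (-(2 + q * b))`. As `n ^ q ≤ m ^ (q * b)`,
the product is below `2 / m ^ 2 ≤ 1 / 2`. -/
theorem pow_halfSlots_mul_lt {q b m n : ℕ} {β : ℝ} (hm : 2 ≤ m) (hn : n ≤ m ^ b) (hβ : 0 < β)
    (hβ' : β ≤ 1) : (1 - β / 2) ^ halfSlots q b m β * (2 * (n : ℝ) ^ q) < 1 / 2 := by
  set N := halfSlots q b m β with hN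
  have hmR : (2 : ℝ) ≤ m := by exact_mod_cast hm
  have hlog := half_le_log hm
  have hNgt : 2 / β * ((2 + q * b) * Real.log m) < N := by
    rw [hN, halfSlots]; push_cast; exact Nat.lt_floor_add_one _
  have h₁ : (1 - β / 2) ^ N ≤ Real.exp (-(β / 2) * N) := by
    rw [mul_comm, Real.exp_nat_mul]
    gcongr
    · linarith
    · linarith [Real.add_one_le_exp (-(β / 2))]
  have h₂ : Real.exp (-(β / 2) * N) < Real.exp (-((2 + q * b) * Real.log m)) := by
    apply Real.exp_lt_exp.2
    have : (2 + q * b) * Real.log m < β / 2 * N := by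
      calc (2 + q * b) * Real.log m = β / 2 * (2 / β * ((2 + q * b) * Real.log m)) := by
            field_simp
        _ < β / 2 * N := by gcongr
    linarith
  have h₃ : Real.exp (-((2 + q * b) * Real.log m)) = 1 / ((m : ℝ) ^ 2 * (m : ℝ) ^ (q * b)) := by
    rw [Real.exp_neg, ← pow_add, one_div, ← Real.exp_log (show (0 : ℝ) < m by linarith),
      ← Real.exp_nat_mul, Real.log_exp]
    push_cast
    rfl
  have h₄ : (n : ℝ) ^ q ≤ (m : ℝ) ^ (q * b) := by
    rw [mul_comm q b, pow_mul]
    gcongr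
    exact_mod_cast hn
  have hmp : (0 : ℝ) < (m : ℝ) ^ (q * b) := by positivity
  calc (1 - β / 2) ^ N * (2 * (n : ℝ) ^ q) ≤ (1 - β / 2) ^ N * (2 * (m : ℝ) ^ (q * b)) := by
        have : (0 : ℝ) ≤ (1 - β / 2) ^ N := pow_nonneg (by linarith) _
        gcongr
    _ < 1 / ((m : ℝ) ^ 2 * (m : ℝ) ^ (q * b)) * (2 * (m : ℝ) ^ (q * b)) := by
        rw [← h₃]
        have := h₁.trans_lt h₂
        gcongr
    _ = 2 / (m : ℝ) ^ 2 := by field_simp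
    _ ≤ 1 / 2 := by
        rw [div_le_div_iff₀ (by positivity) (by norm_num)]
        nlinarith

theorem halfSlots_le {q b m : ℕ} {β : ℝ} (hm : 2 ≤ m) (hβ : 0 < β) (hβ' : β ≤ 1) :
    ((2 * halfSlots q b m β + 1 : ℕ) : ℝ) ≤ (14 + 4 * (q * b)) * (Real.log m / β) := by
  have hlog := half_le_log hm
  have hZ : 1 / 2 ≤ Real.log m / β := by rw [le_div_iff₀ hβ]; nlinarith
  have h₁ : (halfSlots q b m β : ℝ) ≤ 2 / β * ((2 + q * b) * Real.log m) + 1 := by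
    rw [halfSlots]; push_cast
    gcongr
    exact Nat.floor_le (by positivity)
  have e : 2 / β * ((2 + q * b) * Real.log m) = 2 * (2 + q * b) * (Real.log m / β) := by
    field_simp
  rw [e] at h₁
  push_cast
  nlinarith

/-- For accuracy, the Laplace tail uses the share `exp (-(3 * c * log m))` of the allowed `m ^
(-c)`, largest at `m = 2`; the failures of the copies must fit into the rest. The first bound serves
privacy. -/
theorem exists_failure_exponent {c : ℝ} (hc : 0 < c) :
    ∃ j : ℕ, (1 / 4 : ℝ) ^ j ≤ 1 / 4 ∧ (1 / 4 : ℝ) ^ j ≤ 1 - Real.exp (-(3 * c * Real.log 2)) := by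
  have hpos : 0 < 1 - Real.exp (-(3 * c * Real.log 2)) := by
    have : Real.exp (-(3 * c * Real.log 2)) < 1 := Real.exp_lt_one_iff.2 (by
      have := Real.log_pos (show (1 : ℝ) < 2 by norm_num)
      have : 0 < 3 * c * Real.log 2 := by positivity
      linarith)
    linarith
  obtain ⟨j, hj⟩ := exists_pow_lt_of_lt_one (lt_min (by norm_num : (0 : ℝ) < 1 / 4) hpos)
    (by norm_num : (1 / 4 : ℝ) < 1)
  exact ⟨j, (hj.trans_le (min_le_left _ _)).le, (hj.trans_le (min_le_right _ _)).le⟩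

/-- Two powers of `m * n` absorb the union bound over births and outputs; each further one gains a
factor `4`, because `m * n ≥ 4`. -/
theorem sq_mul_failure_le {m n : ℕ} (hm : 2 ≤ m) (hn : 2 ≤ n) (j : ℕ) {y : ℝ} (hy : 0 ≤ y) :
    (m : ℝ) ^ 2 * (y / ((m : ℝ) * n) ^ (2 + j)) ≤ y * (1 / 4) ^ j := by
  have hmR : (2 : ℝ) ≤ m := by exact_mod_cast hm
  have hnR : (2 : ℝ) ≤ n := by exact_mod_cast hn
  have hmn : (4 : ℝ) ≤ (m : ℝ) * n := by nlinarith
  have h₁ : (m : ℝ) ^ 2 * 4 ^ j ≤ ((m : ℝ) * n) ^ (2 + j) := by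
    rw [pow_add]
    gcongr
    nlinarith
  rw [one_div, inv_pow, ← div_eq_mul_inv, mul_div_assoc', div_le_div_iff₀ (by positivity)
    (by positivity)]
  calc (m : ℝ) ^ 2 * y * 4 ^ j = y * ((m : ℝ) ^ 2 * 4 ^ j) := by ring
    _ ≤ y * ((m : ℝ) * n) ^ (2 + j) := by gcongr

theorem time_le_of_slots {β lm K C κ L T : ℝ} (hβ : 0 < β) (hZ : 1 / 2 ≤ lm / β) (hK : 14 ≤ K)
    (hL : L ≤ K * (lm / β)) (hT : 0 ≤ T) (hC : C = 8 * K + 24 + (2 * K + 4) * |κ|) :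
    (4 * L + 3) * T ≤ C * (1 / β * T * lm) := by
  set Z := lm / β with hZdef
  have e : C * (1 / β * T * lm) = C * Z * T := by
    rw [hZdef]; field_simp
  have h₂ : 4 * K + 6 ≤ C := by
    rw [hC]; linarith [mul_nonneg (show 0 ≤ 2 * K + 4 by linarith) (abs_nonneg κ)]
  have h₃ : (4 * K + 6) * Z ≤ C * Z := by gcongr
  rw [e]
  exact mul_le_mul_of_nonneg_right (by linarith) hT

theorem space_le_of_slots {β lm K C κ L S s s' w : ℝ} (hβ : 0 < β) (hlog : 1 / 2 ≤ lm)
    (hZ : 1 / 2 ≤ lm / β) (hK : 14 ≤ K) (hL : L ≤ K * (lm / β)) (hw₀ : 0 ≤ w)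
    (hw : w ≤ κ * lm) (hs : 0 ≤ s) (hS : s ≤ S)
    (hs' : s' ≤ (4 * L + 2) * s + (2 * L + 2) * w + 3 * L + 4)
    (hC : C = 8 * K + 24 + (2 * K + 4) * |κ|) :
    s' ≤ C * (1 / β * (S + lm) * lm) := by
  set Z := lm / β with hZdef
  have hκ : w ≤ |κ| * lm := hw.trans (by gcongr; exact le_abs_self κ)
  have hκ₀ := mul_nonneg (show 0 ≤ 2 * K + 4 by linarith) (abs_nonneg κ)
  have hS₀ : 0 ≤ S := hs.trans hS
  have h₂ : (4 * L + 2) * s ≤ (4 * K + 4) * Z * S := by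
    have : 4 * L + 2 ≤ (4 * K + 4) * Z := by linarith
    gcongr
  have h₃ : (2 * L + 2) * w ≤ (2 * K + 4) * Z * (|κ| * lm) := by
    have : 2 * L + 2 ≤ (2 * K + 4) * Z := by linarith
    gcongr
  have h₄ : 3 * L + 4 ≤ (6 * K + 16) * Z * lm := by
    have h₁ : 3 * L + 4 ≤ (3 * K + 8) * Z := by linarith
    have h₀ : 0 ≤ (3 * K + 8) * Z := by positivity
    linarith [mul_le_mul_of_nonneg_left hlog h₀]
  have e : C * (1 / β * (S + lm) * lm) = C * Z * S + C * Z * lm := by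
    rw [hZdef]; field_simp
  have h₅ : (4 * K + 4) * Z * S ≤ C * Z * S := by
    have : 4 * K + 4 ≤ C := by rw [hC]; linarith
    gcongr
  have h₆ : (2 * K + 4) * Z * (|κ| * lm) + (6 * K + 16) * Z * lm ≤ C * Z * lm := by
    have : (2 * K + 4) * |κ| + (6 * K + 16) ≤ C := by rw [hC]; linarith
    calc _ = ((2 * K + 4) * |κ| + (6 * K + 16)) * Z * lm := by ring
      _ ≤ C * Z * lm := by gcongr
  rw [e]
  linarith

end parameters

/-! ### Assembly of the private algorithm -/

theorem StreamAlg.spaceBits_nonneg {w : ℕ} {U O : Type} (A : StreamAlg w U O) :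
    0 ≤ A.spaceBits := by
  unfold StreamAlg.spaceBits
  have : 0 ≤ Real.logb 2 ((⋃ u, (A.step u).residuals).ncard : ℝ) := by
    rcases Nat.eq_zero_or_pos (⋃ u, (A.step u).residuals).ncard with h | h
    · simp [h]
    · exact Real.logb_nonneg (by norm_num) (by exact_mod_cast h)
  positivity

/-- The smooth histogram algorithm for given parameters. -/
theorem exists_private_alg {c : ℝ} (hc : 0 < c) {q b j : ℕ} {κ : ℝ}
    (hj : (1 / 4 : ℝ) ^ j ≤ 1 / 4)
    (hj' : (1 / 4 : ℝ) ^ j ≤ 1 - Real.exp (-(3 * c * Real.log 2)))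
    {U : Type} [Finite U] {m n w W : ℕ} {α ε ρ β S T : ℝ} {f : List U → ℝ}
    (hm : 2 ≤ m) (hmn : m ≤ n ^ b) (hnm : n ≤ m ^ b) (hmw : m < 2 ^ w)
    (hw : (w : ℝ) ≤ κ * Real.log m) (hW : 1 ≤ W) (hα : 0 < α) (hα' : α < 1) (hε : 0 < ε)
    (hρ : 0 < ρ) (hρ' : ρ ≤ α * min ε 1 / (200 * (c + 3) * Real.log m))
    (hf : IsSmooth f m n q ρ β) (A : StreamAlg w U ℝ)
    (hA : A.IsApprox f m (β / 4) ((m : ℝ) ^ (-c) / ((m : ℝ) * n) ^ (2 + j)))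
    (hS : A.spaceBits ≤ S) (hT : A.UpdateTimeLE T) {K C : ℝ} (hK : K = 14 + 4 * (q * b))
    (hC : C = 8 * K + 24 + (2 * K + 4) * |κ|) :
    ∃ A' : StreamAlg w U (ℝ × NNReal),
      IsDP A'.releaseLaw m ε ((m : ℝ) ^ (-c)) ∧
      (∀ σ : List U, σ.length = m →
        ENNReal.ofReal (1 - (m : ℝ) ^ (-c)) ≤ A'.releaseLaw σ
          {y | (1 - α) * f (σ.rtake W)
                  - 6 * c * globalSensitivity f (min m W) * Real.log m / ε ≤ y ∧
               y ≤ (1 + α) * f (σ.rtake W)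
                  + 6 * c * globalSensitivity f (min m W) * Real.log m / ε}) ∧
      A'.spaceBits ≤ C * (1 / β * (S + Real.log m) * Real.log m) ∧
      A'.UpdateTimeLE (C * (1 / β * T * Real.log m)) := by
  have hmR : (2 : ℝ) ≤ m := by exact_mod_cast hm
  have hlog := half_le_log hm
  set lm := Real.log m with hlm
  have hn : 2 ≤ n := by
    by_contra! h
    have : n ^ b ≤ 1 := pow_le_one' (by omega) b
    omega
  set η := min ε 1 with hη
  have hη₀ : 0 < η := lt_min hε one_pos
  have hη₁ : η ≤ 1 := min_le_right _ _
  have hηε : η ≤ ε := min_le_left _ _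
  have hαη : α * η ≤ α := mul_le_of_le_one_right hα.le hη₁
  have hαη' : α * η ≤ ε := (mul_le_of_le_one_left hη₀.le hα'.le).trans hηε
  have hcρ : 0 ≤ c * (ρ * lm) := by positivity
  -- Both noise requirements below are linear in `c * (ρ * lm)` and `ρ * lm`; the coefficient `200`
  -- must exceed the `48 * 4 = 192` of the accuracy bound.
  have hρlm : 200 * (c * (ρ * lm)) + 600 * (ρ * lm) ≤ α * η := by
    rw [le_div_iff₀ (by positivity)] at hρ'
    linarith
  have hρle : ρ ≤ 2 * (ρ * lm) := by
    linarith [mul_le_mul_of_nonneg_left hlog hρ.le]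
  have hρα : 4 * ρ ≤ α := by linarith
  have hρ₄₀ : ρ ≤ 1 / 40 := by linarith
  have hβ := hf.pos
  have hβρ := hf.le
  have hβ₁ : β ≤ 1 := by linarith
  set N := halfSlots q b m β with hN
  set L := 2 * N + 1 with hL
  set y := (m : ℝ) ^ (-c) with hy
  have hye : y = Real.exp (-(c * lm)) := by
    rw [hy, Real.rpow_def_of_pos (by linarith)]
    congr 1; ring
  have hy₀ : 0 < y := by rw [hye]; exact Real.exp_pos _
  have hy₁ : y ≤ 1 := by rw [hye]; exact Real.exp_le_one_iff.2 (by nlinarith)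
  set d := y / ((m : ℝ) * n) ^ (2 + j) with hd
  have hd₀ : 0 ≤ d := by positivity
  have hd₁ : d ≤ 1 := by
    rw [hd, div_le_one (by positivity)]
    have hnR : (2 : ℝ) ≤ n := by exact_mod_cast hn
    exact hy₁.trans (one_le_pow₀ (by nlinarith))
  set D := (m : ℝ) ^ 2 * d with hD
  have hD₀ : 0 ≤ D := by positivity
  have hDle : D ≤ y * (1 / 4) ^ j := sq_mul_failure_le hm hn j hy₀.le
  set Δ := globalSensitivity f (min m W) with hΔ
  set P := histPolicy w L (1 - β / 2) W (noiseScale Δ ρ ε) with hP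
  have hbad : ∀ σ : List U, σ.length = m → ((P.alg A).outputLaw σ).toOuterMeasure
      {o | ¬ OutputGood f W ρ (noiseScale Δ ρ ε) σ o} ≤ ENNReal.ofReal D := fun σ hσ =>
    outputLaw_bad_le A hA hd₀ hd₁ hf (by linarith) (by positivity) (by linarith) hW
      (pow_halfSlots_mul_lt hm hnm hβ hβ₁) (by omega) hmw hσ
      (List.ne_nil_of_length_pos (by omega))
  have hZ : 1 / 2 ≤ lm / β := by rw [le_div_iff₀ hβ]; nlinarith
  have hLZ : (L : ℝ) ≤ K * (lm / β) := by rw [hK]; exact halfSlots_le hm hβ hβ₁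
  have hK₀ : 14 ≤ K := by rw [hK]; linarith [show (0 : ℝ) ≤ 4 * (q * b) by positivity]
  refine ⟨P.alg A, ?_, ?_, ?_, ?_⟩
  -- With this `t` the tail is `m ^ (-c) / m`, at most half of the allowed `δ`; the two failure
  -- events take at most a quarter each.
  · refine isDP_of_outputGood (P.alg A) hf (by omega) hW hρ hρ₄₀ hε (t := (c + 1) * lm)
      (by positivity) ?_ hD₀ ?_ hbad
    · linarith
    · have h₁ : Real.exp (-((c + 1) * lm)) = y / m := by
        rw [hye, show -((c + 1) * lm) = -(c * lm) - lm by ring, Real.exp_sub, hlm,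
          Real.exp_log (by linarith)]
      have h₂ : y / m ≤ y / 2 := by gcongr
      have h₃ : y * (1 / 4) ^ j ≤ y * (1 / 4) := by gcongr
      rw [h₁]
      linarith
  · intro σ hσ
    -- The choice `t = 4 * c * log m` makes `3 / 2 * Δ * t / ε` the additive error `6 * c * Δ * log
    -- m / ε`.
    have h := le_releaseLaw_of_outputGood (P.alg A) hf (by omega) hW (globalSensitivity_nonneg _ _)
      hρ hρ₄₀ hε (t := 4 * c * lm) (δ := y) (α := α) (by positivity) hD₀ ?_ hρα ?_ hσ
      (hbad σ hσ)
    · rwa [show 3 / 2 * globalSensitivity f (min m W) * (4 * c * lm) / ε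
        = 6 * c * Δ * lm / ε by rw [hΔ]; ring] at h
    · have h₁ : Real.exp (-(4 * c * lm)) = y * Real.exp (-(3 * c * lm)) := by
        rw [hye, ← Real.exp_add]; congr 1; ring
      have h₂ : Real.exp (-(3 * c * lm)) ≤ Real.exp (-(3 * c * Real.log 2)) := by
        apply Real.exp_le_exp.2
        have : Real.log 2 ≤ lm := Real.log_le_log (by norm_num) hmR
        linarith [mul_le_mul_of_nonneg_left this (show 0 ≤ 3 * c by positivity)]
      have h₃ := mul_le_mul_of_nonneg_left h₂ hy₀.le
      have h₄ := mul_le_mul_of_nonneg_left hj' hy₀.le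
      rw [h₁]
      linarith
    · rw [div_le_iff₀ hε]
      linarith [mul_le_mul_of_nonneg_left hηε hα.le]
  · exact space_le_of_slots hβ hlog hZ hK₀ hLZ (Nat.cast_nonneg w) hw
      A.spaceBits_nonneg hS (P.spaceBits_alg_le A) hC
  · intro u
    refine (P.updateTimeLE_alg A hT u).trans ?_
    exact time_le_of_slots hβ hZ hK₀ hLZ ((Nat.cast_nonneg _).trans (hT u)) hC

end DPHist

end

open DPHist in
theorem mainTheorem4 (c : ℝ) (hc : 0 < c) (q b : ℕ) (κ : ℝ) :
    ∃ (C₁ C₂ C₃ : ℝ) (k : ℕ), 1 ≤ C₁ ∧ 1 ≤ C₂ ∧ 1 ≤ C₃ ∧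
      ∀ (U : Type) [Finite U] (m n w W : ℕ) (α ε ρ : ℝ) (f : List U → ℝ) (β : ℝ → ℝ)
        (S T : ℝ → ℝ → ℕ → ℕ → ℝ),
        2 ≤ m → m ≤ n ^ b → n ≤ m ^ b →
        m < 2 ^ w → (w : ℝ) ≤ κ * Real.log m →
        1 ≤ W → 0 < α → α < 1 → 0 < ε →
        0 < ρ → ρ ≤ α * min ε 1 / (C₁ * Real.log m) →
        IsSmooth f m n q ρ (β ρ) →
        (∀ a d : ℝ, 0 < a → a < 1 → 0 < d → d < 1 →
          ∃ A : StreamAlg w U ℝ, A.IsApprox f m a d ∧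
            A.spaceBits ≤ S a d m n ∧ A.UpdateTimeLE (T a d m n)) →
        ∃ A' : StreamAlg w U (ℝ × NNReal),
          IsDP A'.releaseLaw m ε ((m : ℝ) ^ (-c)) ∧
          (∀ σ : List U, σ.length = m →
            ENNReal.ofReal (1 - (m : ℝ) ^ (-c)) ≤ A'.releaseLaw σ
              {y | (1 - α) * f (σ.rtake W)
                      - 6 * c * globalSensitivity f (min m W) * Real.log m / ε ≤ y ∧
                   y ≤ (1 + α) * f (σ.rtake W)
                      + 6 * c * globalSensitivity f (min m W) * Real.log m / ε}) ∧
          A'.spaceBits ≤ C₃ * (1 / β ρ *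
            (S (β ρ / C₂) ((m : ℝ) ^ (-c) / ((m : ℝ) * n) ^ k) m n + Real.log m) * Real.log m) ∧
          A'.UpdateTimeLE (C₃ * (1 / β ρ *
            T (β ρ / C₂) ((m : ℝ) ^ (-c) / ((m : ℝ) * n) ^ k) m n * Real.log m)) := by
  obtain ⟨j, hj, hj'⟩ := exists_failure_exponent hc
  set K : ℝ := 14 + 4 * (q * b) with hK
  have hK₀ : 14 ≤ K := by rw [hK]; linarith [show (0 : ℝ) ≤ 4 * (q * b) by positivity]
  refine ⟨200 * (c + 3), 4, 8 * K + 24 + (2 * K + 4) * |κ|, 2 + j, by linarith, by norm_num,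
    by linarith [mul_nonneg (show 0 ≤ 2 * K + 4 by linarith) (abs_nonneg κ)], ?_⟩
  intro U _ m n w W α ε ρ f β S T hm hmn hnm hmw hw hW hα hα' hε hρ hρ' hf hA
  have hlog := half_le_log hm
  have hmR : (2 : ℝ) ≤ m := by exact_mod_cast hm
  have hn : (1 : ℝ) ≤ n := by
    have : n ≠ 0 := by
      rintro rfl
      rcases Nat.eq_zero_or_pos b with rfl | hb
      · simp at hmn; omega
      · rw [zero_pow hb.ne'] at hmn; omega
    exact_mod_cast Nat.one_le_iff_ne_zero.2 this
  have hρ₁ : ρ ≤ 1 := by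
    refine hρ'.trans ?_
    rw [div_le_one (by positivity)]
    have : α * min ε 1 ≤ 1 := by
      have := min_le_right ε 1
      have : 0 < min ε 1 := lt_min hε one_pos
      nlinarith
    nlinarith
  have hy : (m : ℝ) ^ (-c) < 1 := Real.rpow_lt_one_of_one_lt_of_neg (by linarith) (by linarith)
  -- The accuracy `β ρ / 4` is the largest that pruning tolerates, whence `C₂ = 4`.
  obtain ⟨A, hA₁, hA₂, hA₃⟩ := hA (β ρ / 4) ((m : ℝ) ^ (-c) / ((m : ℝ) * n) ^ (2 + j))
    (by linarith [hf.pos]) (by linarith [hf.le]) (by positivity)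
    ((div_le_self (by positivity) (one_le_pow₀ (by nlinarith))).trans_lt hy)
  exact exists_private_alg hc hj hj' hm hmn hnm hmw hw hW hα hα' hε hρ hρ' hf A hA₁ hA₂ hA₃ hK rfl
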